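/- **Proposition (operators commuting with right ladder operators).** Let $n\in\mathbb N$, $\hbar>0$, $\tau>0$, $h=2\pi\hbar$, and identify $(x,y)\in\mathbb R^{2n}$ with $z=\sqrt{h/(2\tau)}\,(x+\mathrm i\tau y)\in\mathbb C^n$, so that $L^2(\mathbb C^n)=L^2(\mathbb R^{2n})$. Inner products $\langle\cdot,\cdot\rangle$ are linear in the first argument. Let $$[\Lambda(s,x,y)f](x',y')=e^{\pi\mathrm i\hbar(2s+xy'-yx')}f(x'-x,y'-y),\qquad [R(s,x,y)f](x',y')=e^{\pi\mathrm i\hbar(-2s+xy'-yx')}f(x'+x,y'+y)$$ be the left and right pulled actions of the Heisenberg group on $\mathbb R^{2n}$, with derived operators $dR^{X_j}=\pi\mathrm i\hbar y_j+\partial_{x_j}$, $dR^{Y_j}=-\pi\mathrm i\hbar x_j+\partial_{y_j}$, and let $$a^{\pm}_{R,j}=\frac1{\sqrt{2|h|\tau}}\bigl(\pm\tau\,dR^{X_j}+\mathrm i\,dR^{Y_j}\bigr),\qquad j=1,\dots,n,$$ be the right ladder operators, acting on tempered distributions. Let $[\rho(s,x,y)f](t)=e^{\pi\mathrm i\hbar(2s-2yt+xy)}f(t-x)$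 be the Schrödinger representation on $L^2(\mathbb R^n)$, let $\varphi(t)=e^{-\pi\hbar|t|^2/\tau}$, and let $F\subset L^2(\mathbb R^{2n})$ be the pre-Fock–Segal–Bargmann space of all functions $(x,y)\mapsto\langle f,\rho(0,x,y)\varphi\rangle$, $f\in L^2(\mathbb R^n)$. For a multi-index $m\in\mathbb N_0^n$ let $F_m=\prod_{j}(a^-_{R,j})^{m_j}F\subset L^2(\mathbb R^{2n})$ be the true poly-analytic space of index $m$. Let $A$ be a bounded operator on $L^2(\mathbb C^n)$ that commutes with all right ladder operators, that is, $a^{\pm}_{R,j}(Au)=A(a^{\pm}_{R,j}u)$ for all $j$ and all Schwartz functions $u$, where $a^{\pm}_{R,j}(Au)$ is taken in the sense of distributions. Then: 1. $A F_m\subseteq F_m$ for every $m\in\mathbb N_0^n$; 2. $A$ is a left relative convolution on $L^2(\mathbb C^n)$: there is a tempered distribution $k$ on $\mathbb R^{2n}$ such that $A=\Lambda(k)=\int_{\mathbb R^{2n}}k(x,y)\,\Lambda(0,x,y)\,dx\,dy$ in the weak sense, that is, for all Schwartz functions $u,v$ on $\mathbb R^{2n}$ the function $(x,y)\mapsto\langle\Lambda(0,x,y)u,v\rangle$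 is a Schwartz function, and $k$ applied (bilinearly) to it gives $\langle Au,v\rangle$. -/

import Mathlib

open MeasureTheory SchwartzMap LineDeriv
open scoped ComplexConjugate

noncomputable section

namespace FockHeisenberg

/-- The configuration space `ℝⁿ`. -/
abbrev Config (n : ℕ) : Type := EuclideanSpace ℝ (Fin n)

/-- The phase space `ℝ²ⁿ = ℝⁿ × ℝⁿ` of pairs `(x, y)`, with Lebesgue measure. It is identified with
`ℂⁿ` through the linear coordinate `z = √(h / (2 τ)) (x + i τ y)`. -/
abbrev Phase (n : ℕ) : Type := Config n × Config n

/-- `L²(ℝⁿ)`. -/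
abbrev L2Config (n : ℕ) : Type := Lp ℂ 2 (volume : Measure (Config n))

/-- `L²(ℝ²ⁿ) = L²(ℂⁿ)`. -/
abbrev L2Phase (n : ℕ) : Type := Lp ℂ 2 (volume : Measure (Phase n))

instance instIsAddHaarMeasurePhase (n : ℕ) :
    (volume : Measure (Phase n)).IsAddHaarMeasure :=
  inferInstanceAs (((volume : Measure (Config n)).prod (volume : Measure (Config n))).IsAddHaarMeasure)

/-- Continuous linear operators on the tempered distributions on phase space. -/
abbrev DistOp (n : ℕ) : Type := 𝓢'(Phase n, ℂ) →L[ℂ] 𝓢'(Phase n, ℂ)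

variable {n : ℕ}

/-! ### Representations of the Heisenberg group -/

/-- The left pulled action of the element `(s, x, y) = (s, g)` of the Heisenberg group,
`[Λ(s,x,y) f](x', y') = exp(π i ħ (2 s + x y' - y x')) f(x' - x, y' - y)`. -/
def leftAction (ħ s : ℝ) (g : Phase n) (f : Phase n → ℂ) : Phase n → ℂ := fun p =>
  Complex.exp (Real.pi * Complex.I * ħ *
    ((2 * s + inner ℝ g.1 p.2 - inner ℝ g.2 p.1 : ℝ) : ℂ)) * f (p - g)

/-- The Schrödinger representation of the element `(s, x, y) = (s, g)` of the Heisenberg group,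
`[ρ(s,x,y) f](t) = exp(π i ħ (2 s - 2 y t + x y)) f(t - x)`. -/
def schrodinger (ħ s : ℝ) (g : Phase n) (f : Config n → ℂ) : Config n → ℂ := fun t =>
  Complex.exp (Real.pi * Complex.I * ħ *
    ((2 * s - 2 * inner ℝ g.2 t + inner ℝ g.1 g.2 : ℝ) : ℂ)) * f (t - g.1)

/-! ### Right ladder operators -/

/-- The derived right pulled action of `X_j`, that is `π i ħ y_j + ∂/∂x_j`. The right pulled action
is `[R(s,x,y) f](x', y') = exp(π i ħ (-2 s + x y' - y x')) f(x' + x, y' + y)`. -/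
def dRX (ħ : ℝ) (j : Fin n) : DistOp n :=
  (Real.pi * Complex.I * ħ : ℂ) • TemperedDistribution.smulLeftCLM ℂ
      (fun p : Phase n => ((p.2 j : ℝ) : ℂ))
    + lineDerivOpCLM ℂ 𝓢'(Phase n, ℂ) ((EuclideanSpace.single j (1 : ℝ), 0) : Phase n)

/-- The derived right pulled action of `Y_j`, that is `-π i ħ x_j + ∂/∂y_j`. -/
def dRY (ħ : ℝ) (j : Fin n) : DistOp n :=
  (-(Real.pi * Complex.I * ħ) : ℂ) • TemperedDistribution.smulLeftCLM ℂ
      (fun p : Phase n => ((p.1 j : ℝ) : ℂ))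
    + lineDerivOpCLM ℂ 𝓢'(Phase n, ℂ) ((0, EuclideanSpace.single j (1 : ℝ)) : Phase n)

/-- The right ladder operator `a⁺_{R,j} = (2 |h| τ)^{-1/2} (τ dR^{X_j} + i dR^{Y_j})`, where
`h = 2 π ħ`, acting on tempered distributions. -/
def rightLadderPlus (ħ τ : ℝ) (j : Fin n) : DistOp n :=
  ((1 / √(2 * |2 * Real.pi * ħ| * τ) : ℝ) : ℂ) • ((τ : ℂ) • dRX ħ j + Complex.I • dRY ħ j)

/-- The right ladder operator `a⁻_{R,j} = (2 |h| τ)^{-1/2} (-τ dR^{X_j} + i dR^{Y_j})`, where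
`h = 2 π ħ`, acting on tempered distributions. -/
def rightLadderMinus (ħ τ : ℝ) (j : Fin n) : DistOp n :=
  ((1 / √(2 * |2 * Real.pi * ħ| * τ) : ℝ) : ℂ) • (-(τ : ℂ) • dRX ħ j + Complex.I • dRY ħ j)

/-- A square integrable function on phase space, as a tempered distribution. -/
def toDist (f : L2Phase n) : 𝓢'(Phase n, ℂ) := Lp.toTemperedDistribution f

/-- A bounded operator `A` on `L²(ℝ²ⁿ)` commutes with a ladder operator `T`, `[T, A] = 0`: for every
Schwartz function `u` the (distributional) value `T (A u)` is the `L²` function `A (T u)`. Here `w`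
stands for `T u`, which is a Schwartz function again, so in `L²(ℝ²ⁿ)`. -/
def CommutesWith (A : L2Phase n →L[ℂ] L2Phase n) (T : DistOp n) : Prop :=
  ∀ (u : 𝓢(Phase n, ℂ)) (w : L2Phase n), toDist w = T (toDist (u.toLp 2)) →
    T (toDist (A (u.toLp 2))) = toDist (A w)

/-! ### True poly-analytic spaces -/

/-- The squeezed Gaussian `φ(t) = exp(-π ħ |t|² / τ)`. -/
def gaussian (ħ τ : ℝ) : Config n → ℂ := fun t =>
  Complex.exp ((-(Real.pi * ħ * ‖t‖ ^ 2 / τ) : ℝ) : ℂ)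

/-- The covariant (coherent state) transform `[W_θ f](x, y) = ⟨f, ρ(0,x,y) θ⟩`, with inner products
linear in the first argument. -/
def covariantTransform (ħ : ℝ) (θ f : Config n → ℂ) : Phase n → ℂ := fun g =>
  ∫ t, f t * conj (schrodinger ħ 0 g θ t)

/-- The pre-Fock--Segal--Bargmann space `F`: the image of `L²(ℝⁿ)` under the covariant transform
with the squeezed Gaussian. -/
def preFSBSpace (n : ℕ) (ħ τ : ℝ) : Set (L2Phase n) :=
  {F | ∃ f : L2Config n, F =ᵐ[volume] covariantTransform ħ (gaussian ħ τ) f}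

/-- The true poly-analytic space `F_m = (a⁻_R)^m F` with a multi-index `m`, where
`(a⁻_R)^m = ∏_j (a⁻_{R,j})^{m_j}` (the factors commute). -/
def truePolyanalyticSpace (ħ τ : ℝ) (m : Fin n → ℕ) : Set (L2Phase n) :=
  {F | ∃ f ∈ preFSBSpace n ħ τ,
    toDist F = (List.ofFn fun j => rightLadderMinus ħ τ j ^ m j).prod (toDist f)}

/-! ### Relative convolutions -/

/-- The matrix coefficient `(x, y) ↦ ⟨Λ(0,x,y) u, v⟩` of the left pulled action, with inner products
linear in the first argument. -/
def leftCoefficient (ħ : ℝ) (u v : Phase n → ℂ) : Phase n → ℂ := fun g =>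
  ∫ p, leftAction ħ 0 g u p * conj (v p)

/-- `A` is the left relative convolution `Λ(k) = ∫ k(x,y) Λ(0,x,y) dx dy` with the kernel
`k ∈ 𝓢'(ℝ²ⁿ)`, in the weak sense: for all Schwartz functions `u`, `v` the matrix coefficient
`⟨Λ(0,x,y) u, v⟩` is a Schwartz function of `(x, y)`, and `k` takes the value `⟨A u, v⟩` on it. -/
def IsLeftRelativeConvolutionWith (ħ : ℝ) (k : 𝓢'(Phase n, ℂ))
    (A : L2Phase n →L[ℂ] L2Phase n) : Prop :=
  ∀ u v : 𝓢(Phase n, ℂ), ∃ c : 𝓢(Phase n, ℂ), (c : Phase n → ℂ) = leftCoefficient ħ u v ∧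
    k c = inner ℂ (v.toLp 2 : L2Phase n) (A (u.toLp 2))

/-- `A` is a left relative convolution with some tempered distribution as the kernel. -/
def IsLeftRelativeConvolution (ħ : ℝ) (A : L2Phase n →L[ℂ] L2Phase n) : Prop :=
  ∃ k : 𝓢'(Phase n, ℂ), IsLeftRelativeConvolutionWith ħ k A

end FockHeisenberg

end

noncomputable section

namespace FockHeisenberg

variable {n : ℕ}

/-! ### Phase factors of temperate growth -/

/-! Write Λ(g) and R(g) for the left and right actions of the elements (0,g). Sums and differences
of the ladder operators recover dR^X and dR^Y, so A commutes weakly with every generator of R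
(`commutesWithDerR_of_commutesWith`). These generators are skew-adjoint, so for Schwartz u, v the
function t ↦ ⟨A R(th)u, R(th)v⟩ has zero derivative. Hence A commutes with each R(h)
(`CommutesWithDerR.rightOp_apply`), and so with conv(w) = ∫ w(h) R(-h) dh for every Schwartz w. A
substitution turns conv(w)a into ∫ a(q) Λ(q)w dq: tested against ψ, it is a tested against the
coefficient coef(w,ψ)(q) = ∫ (Λ(q)w)ψ, a Schwartz function (`toDist_conv`, `exists_coef`). Both
claims follow from this twisted convolution.

Kernel. Formally u = conv(u)δ, so Au = conv(u)(Aδ) and the kernel should be Aδ. Since δ is not in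
L², it is written as δ = γ ∘ D with γ in L² and D a differential operator on test functions
(`exists_fundamental_fundOp`). D is built from squares of the generators of Λ, so that D coef(u,ψ) =
coef(Du,ψ). Then u = conv(Du)γ, Au = conv(Du)(Aγ), and k = (Aγ) ∘ D is the kernel.

Poly-analytic spaces. Let W be the covariant transform with the Gaussian φ, and Φ = Wφ. By
Plancherel W*W is a positive scalar, and W intertwines the Schrödinger representation with Λ.
Therefore conv(Φ) = WW* and its range is F (`conv_eq_transform_adjoint`). A right ladder operator
acts on conv(w)a only through w, so F_m consists of vectors conv(Ψ)b with Ψ obtained from Φ by the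
ladder operators. A moves past conv(Ψ), and A conv(Ψ)b = conv(Ψ)(Ab) comes from conv(Φ)(Ab), which
lies in F. -/

theorem hasTemperateGrowth_cexp_mul_I :
    (fun t : ℝ => Complex.exp (t * Complex.I)).HasTemperateGrowth := by
  have hderiv : ∀ k : ℕ, iteratedDeriv k (fun t : ℝ => Complex.exp (t * Complex.I))
      = fun t : ℝ => Complex.I ^ k * Complex.exp (t * Complex.I) := by
    intro k
    induction k with
    | zero => simp
    | succ k ih =>
      rw [iteratedDeriv_succ, ih]
      funext t
      have h : HasDerivAt (fun t : ℝ => Complex.exp (t * Complex.I))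
          (Complex.exp (t * Complex.I) * (1 * Complex.I)) t :=
        ((Complex.ofRealCLM.hasDerivAt (x := t)).mul_const Complex.I).cexp
      rw [(h.const_mul (Complex.I ^ k)).deriv]
      ring
  refine ⟨?_, fun k => ⟨0, 1, fun t => ?_⟩⟩
  · exact (Complex.ofRealCLM.contDiff.mul contDiff_const).cexp
  · rw [norm_iteratedFDeriv_eq_norm_iteratedDeriv, hderiv]
    simp [Complex.norm_exp_ofReal_mul_I]

/-- The unimodular function `p ↦ exp(π i ħ ℓ(p))` for a linear form `ℓ`. -/
def phaseFactor {E : Type*} [NormedAddCommGroup E] [NormedSpace ℝ E] (ħ : ℝ) (ℓ : E →L[ℝ] ℝ) :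
    E → ℂ := fun p => Complex.exp (((Real.pi * ħ * ℓ p : ℝ) : ℂ) * Complex.I)

section PhaseFactor

variable {E : Type*} [NormedAddCommGroup E] [NormedSpace ℝ E] (ħ : ℝ) (ℓ : E →L[ℝ] ℝ)

@[fun_prop]
theorem phaseFactor_hasTemperateGrowth : (phaseFactor ħ ℓ).HasTemperateGrowth :=
  hasTemperateGrowth_cexp_mul_I.comp ((Real.pi * ħ) • ℓ).hasTemperateGrowth

@[simp]
theorem norm_phaseFactor (p : E) : ‖phaseFactor ħ ℓ p‖ = 1 :=
  Complex.norm_exp_ofReal_mul_I _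

@[fun_prop]
theorem continuous_phaseFactor : Continuous (phaseFactor ħ ℓ) :=
  (phaseFactor_hasTemperateGrowth ħ ℓ).1.continuous

@[simp]
theorem phaseFactor_zero_left (p : E) : phaseFactor ħ (0 : E →L[ℝ] ℝ) p = 1 := by
  simp [phaseFactor]

theorem hasFDerivAt_phaseFactor (p : E) :
    HasFDerivAt (phaseFactor ħ ℓ)
      ((phaseFactor ħ ℓ p * (Real.pi * Complex.I * ħ)) • (Complex.ofRealCLM ∘L ℓ)) p := by
  have h : HasFDerivAt (fun p : E => ((Real.pi * ħ * ℓ p : ℝ) : ℂ) * Complex.I) _ p :=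
    ((Complex.ofRealCLM ∘L ((Real.pi * ħ) • ℓ)).hasFDerivAt (x := p)).mul_const Complex.I
  convert! h.cexp using 1
  ext v
  simp [phaseFactor]
  ring

end PhaseFactor

/-! ### Twisted translations and the generators of the two actions. -/

/-- The symplectic form `(x, y) ∧ (x', y') = x y' - y x'` on phase space. -/
def symp (n : ℕ) : Phase n →L[ℝ] Phase n →L[ℝ] ℝ :=
  (innerSL ℝ).bilinearComp (ContinuousLinearMap.fst ℝ _ _) (ContinuousLinearMap.snd ℝ _ _)
    - (innerSL ℝ).bilinearComp (ContinuousLinearMap.snd ℝ _ _) (ContinuousLinearMap.fst ℝ _ _)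

theorem symp_apply (a p : Phase n) : symp n a p = inner ℝ a.1 p.2 - inner ℝ a.2 p.1 := by
  simp [symp]

@[simp]
theorem symp_self (a : Phase n) : symp n a a = 0 := by
  rw [symp_apply, real_inner_comm, sub_self]

theorem symp_swap (a p : Phase n) : symp n a p = -symp n p a := by
  rw [symp_apply, symp_apply, real_inner_comm, real_inner_comm p.1]
  ring

/-- The function `p ↦ exp(π i ħ (a ∧ p)) u(p + b)` for a Schwartz function `u`. -/
def twist (ħ : ℝ) (a b : Phase n) : 𝓢(Phase n, ℂ) →L[ℂ] 𝓢(Phase n, ℂ) :=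
  smulLeftCLM ℂ (phaseFactor ħ (symp n a)) ∘L compSubConstCLM ℂ (-b)

@[simp]
theorem twist_apply (ħ : ℝ) (a b : Phase n) (u : 𝓢(Phase n, ℂ)) (p : Phase n) :
    twist ħ a b u p = phaseFactor ħ (symp n a) p * u (p + b) := by
  simp [twist, smulLeftCLM_apply_apply (phaseFactor_hasTemperateGrowth ħ (symp n a))]

/-- Multiplication of a Schwartz function by a real linear form. -/
def linMul (ℓ : Phase n →L[ℝ] ℝ) : 𝓢(Phase n, ℂ) →L[ℂ] 𝓢(Phase n, ℂ) :=
  smulLeftCLM ℂ (fun p => ((ℓ p : ℝ) : ℂ))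

theorem ofReal_clm_hasTemperateGrowth {E : Type*} [NormedAddCommGroup E] [NormedSpace ℝ E]
    (ℓ : E →L[ℝ] ℝ) : (fun p => ((ℓ p : ℝ) : ℂ)).HasTemperateGrowth :=
  (Complex.ofRealCLM ∘L ℓ).hasTemperateGrowth

@[simp]
theorem linMul_apply (ℓ : Phase n →L[ℝ] ℝ) (u : 𝓢(Phase n, ℂ)) (p : Phase n) :
    linMul ℓ u p = ℓ p * u p := by
  simp [linMul, smulLeftCLM_apply_apply (ofReal_clm_hasTemperateGrowth ℓ)]

/-- The derived right pulled action `∂_e + π i ħ (e ∧ ·)` on Schwartz functions. -/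
def derR (ħ : ℝ) (e : Phase n) : 𝓢(Phase n, ℂ) →L[ℂ] 𝓢(Phase n, ℂ) :=
  lineDerivOpCLM ℂ 𝓢(Phase n, ℂ) e + (Real.pi * Complex.I * ħ : ℂ) • linMul (symp n e)

/-- The transpose `-∂_e + π i ħ (e ∧ ·)` of the derived right pulled action. -/
def derL (ħ : ℝ) (e : Phase n) : 𝓢(Phase n, ℂ) →L[ℂ] 𝓢(Phase n, ℂ) :=
  -lineDerivOpCLM ℂ 𝓢(Phase n, ℂ) e + (Real.pi * Complex.I * ħ : ℂ) • linMul (symp n e)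

theorem derR_apply (ħ : ℝ) (e : Phase n) (u : 𝓢(Phase n, ℂ)) (p : Phase n) :
    derR ħ e u p = fderiv ℝ u p e + Real.pi * Complex.I * ħ * (symp n e p * u p) := by
  simp [derR, lineDerivOp_apply_eq_fderiv]

theorem derL_apply (ħ : ℝ) (e : Phase n) (u : 𝓢(Phase n, ℂ)) (p : Phase n) :
    derL ħ e u p = -fderiv ℝ u p e + Real.pi * Complex.I * ħ * (symp n e p * u p) := by
  simp [derL, lineDerivOp_apply_eq_fderiv]

theorem integrable_mul_schwartz (u v : 𝓢(Phase n, ℂ)) : Integrable (fun p => u p * v p) := by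
  exact (u.integrable (μ := volume)).mul_bdd (c := SchwartzMap.seminorm ℝ 0 0 v)
    v.continuous.aestronglyMeasurable (Filter.Eventually.of_forall fun p => norm_le_seminorm ℝ v p)

/-- Integration by parts changes the sign of the derivative, while multiplication by the linear form
is its own transpose. The transpose `derL` is also the generator of the left action t ↦ Λ(0, te). -/
theorem integral_derR_mul (ħ : ℝ) (e : Phase n) (u ψ : 𝓢(Phase n, ℂ)) :
    ∫ p, derR ħ e u p * ψ p = ∫ p, u p * derL ħ e ψ p := by
  have h := integral_mul_lineDerivOp_right_eq_neg_left (μ := volume) u ψ e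
  have h1 : ∀ p, derR ħ e u p * ψ p = ∂_{e} u p * ψ p
      + (Real.pi * Complex.I * ħ) * (linMul (symp n e) u p * ψ p) := by
    intro p
    simp [derR]
    ring
  have h2 : ∀ p, u p * derL ħ e ψ p = -(u p * ∂_{e} ψ p)
      + (Real.pi * Complex.I * ħ) * (linMul (symp n e) u p * ψ p) := by
    intro p
    simp [derL]
    ring
  simp_rw [h1, h2]
  rw [integral_add (integrable_mul_schwartz _ _) ((integrable_mul_schwartz _ _).const_mul _),
    integral_add (integrable_mul_schwartz u (∂_{e} ψ)).fun_neg ((integrable_mul_schwartz _ _).const_mul _),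
    integral_neg, h]
  simp

theorem hasFDerivAt_twist (ħ : ℝ) (a b : Phase n) (u : 𝓢(Phase n, ℂ)) (p : Phase n) :
    HasFDerivAt (twist ħ a b u)
      (phaseFactor ħ (symp n a) p • fderiv ℝ u (p + b) + u (p + b) •
        ((phaseFactor ħ (symp n a) p * (Real.pi * Complex.I * ħ)) •
          (Complex.ofRealCLM ∘L symp n a))) p := by
  have h1 := hasFDerivAt_phaseFactor ħ (symp n a) p
  have h2 : HasFDerivAt (fun p => u (p + b)) (fderiv ℝ u (p + b)) p := by
    exact (u.hasFDerivAt (p + b)).comp p ((hasFDerivAt_id p).add_const b)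
  have h3 := h1.mul h2
  refine (h3.congr_of_eventuallyEq (Filter.Eventually.of_forall fun q => ?_))
  simp

/-- The left pulled action commutes with the derived right pulled action. -/
theorem derR_twist_neg (ħ : ℝ) (e g : Phase n) (u : 𝓢(Phase n, ℂ)) :
    derR ħ e (twist ħ g (-g) u) = twist ħ g (-g) (derR ħ e u) := by
  ext p
  rw [derR_apply, (hasFDerivAt_twist ħ g (-g) u p).fderiv, twist_apply, twist_apply, derR_apply]
  simp only [add_apply, smul_apply, ContinuousLinearMap.comp_apply, smul_eq_mul,
    Complex.ofRealCLM_apply, map_add, map_neg, symp_swap e g]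
  push_cast
  ring

/-! ### Matrix coefficients of the left pulled action are Schwartz functions -/

section Family

variable {E : Type*} [NormedAddCommGroup E] [NormedSpace ℝ E] [FiniteDimensional ℝ E]

theorem fderiv_eq_sum_basis {ι : Type*} [Fintype ι] (b : Module.Basis ι ℝ E) (f : E → ℂ) (x : E) :
    fderiv ℝ f x = ∑ i, ContinuousLinearMap.smulRightL ℝ E ℂ (b.coord i).toContinuousLinearMap
      (fderiv ℝ f x (b i)) := by
  ext v
  conv_lhs => rw [← b.sum_repr v, map_sum]
  simp

/-- A family of bounded differentiable functions which is closed under directional derivatives and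
under multiplication by real linear forms consists of Schwartz functions. -/
theorem exists_schwartzMap_of_family (V : Set (E → ℂ))
    (hbdd : ∀ f ∈ V, ∃ C, ∀ x, ‖f x‖ ≤ C)
    (hdiff : ∀ f ∈ V, Differentiable ℝ f)
    (hderiv : ∀ f ∈ V, ∀ e, (fun x => fderiv ℝ f x e) ∈ V)
    (hmul : ∀ f ∈ V, ∀ ℓ : E →L[ℝ] ℝ, (fun x => (ℓ x : ℂ) * f x) ∈ V)
    {f : E → ℂ} (hf : f ∈ V) : ∃ s : 𝓢(E, ℂ), (s : E → ℂ) = f := by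
  -- In a basis the powers of the norm and the iterated derivatives reduce to coordinate forms and
  -- directional derivatives. Induction on the order keeps every function inside the family, where
  -- only boundedness is needed.
  set b := Module.finBasis ℝ E
  have hcont : ∀ (k : ℕ), ∀ f ∈ V, ContDiff ℝ k f := by
    intro k
    induction k with
    | zero => exact fun f hf => contDiff_zero.2 (hdiff f hf).continuous
    | succ k ih =>
      intro f hf
      refine contDiff_succ_iff_fderiv_apply.2 ⟨hdiff f hf, ?_, fun y => ih _ (hderiv f hf y)⟩
      intro h
      exact absurd h (by simp)
  have hdecay0 : ∀ (k : ℕ), ∀ f ∈ V, ∃ C, ∀ x, ‖x‖ ^ k * ‖f x‖ ≤ C := by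
    intro k
    induction k with
    | zero => simpa using hbdd
    | succ k ih =>
      intro f hf
      choose C hC using fun i => ih _ (hmul f hf (b.coord i).toContinuousLinearMap)
      refine ⟨∑ i, C i * ‖b i‖, fun x => ?_⟩
      have hx : ‖x‖ ≤ ∑ i, ‖b.coord i x‖ * ‖b i‖ := by
        conv_lhs => rw [← b.sum_repr x]
        refine (norm_sum_le _ _).trans (le_of_eq ?_)
        simp [norm_smul]
      calc ‖x‖ ^ (k + 1) * ‖f x‖ = ‖x‖ ^ k * ‖f x‖ * ‖x‖ := by ring
        _ ≤ ‖x‖ ^ k * ‖f x‖ * ∑ i, ‖b.coord i x‖ * ‖b i‖ := by gcongr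
        _ = ∑ i, ‖x‖ ^ k * (‖b.coord i x‖ * ‖f x‖) * ‖b i‖ := by
          rw [Finset.mul_sum]
          exact Finset.sum_congr rfl fun i _ => by ring
        _ ≤ ∑ i, C i * ‖b i‖ := by
          refine Finset.sum_le_sum fun i _ => ?_
          have := hC i x
          simp only [norm_mul, LinearMap.coe_toContinuousLinearMap', Complex.norm_real] at this
          gcongr
  have hdecay : ∀ (m : ℕ), ∀ f ∈ V, ∀ k : ℕ, ∃ C, ∀ x, ‖x‖ ^ k * ‖iteratedFDeriv ℝ m f x‖ ≤ C := by
    intro m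
    induction m with
    | zero => simpa using fun f hf k => hdecay0 k f hf
    | succ m ih =>
      intro f hf k
      choose C hC using fun i => ih _ (hderiv f hf (b i)) k
      set Φ := fun i => ContinuousLinearMap.smulRightL ℝ E ℂ (b.coord i).toContinuousLinearMap
      refine ⟨∑ i, ‖Φ i‖ * C i, fun x => ?_⟩
      have hcd : ∀ i, ContDiff ℝ m (fun x => fderiv ℝ f x (b i)) :=
        fun i => hcont m _ (hderiv f hf (b i))
      have h1 : fderiv ℝ f = fun x => ∑ i, (Φ i ∘ fun x => fderiv ℝ f x (b i)) x := by
        funext x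
        exact fderiv_eq_sum_basis b f x
      rw [← norm_iteratedFDeriv_fderiv, h1, iteratedFDeriv_sum
        (fun i _ => ((Φ i).contDiff.comp (hcd i)))]
      rw [Finset.sum_apply]
      calc ‖x‖ ^ k * ‖∑ i, iteratedFDeriv ℝ m (Φ i ∘ fun x => fderiv ℝ f x (b i)) x‖
          ≤ ‖x‖ ^ k * ∑ i, ‖Φ i‖ * ‖iteratedFDeriv ℝ m (fun x => fderiv ℝ f x (b i)) x‖ := by
            gcongr
            refine (norm_sum_le _ _).trans (Finset.sum_le_sum fun i _ => ?_)
            rw [(Φ i).iteratedFDeriv_comp_left (hcd i).contDiffAt le_rfl]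
            exact (Φ i).norm_compContinuousMultilinearMap_le _
        _ = ∑ i, ‖Φ i‖ * (‖x‖ ^ k * ‖iteratedFDeriv ℝ m (fun x => fderiv ℝ f x (b i)) x‖) := by
            rw [Finset.mul_sum]
            exact Finset.sum_congr rfl fun i _ => by ring
        _ ≤ ∑ i, ‖Φ i‖ * C i := by
            gcongr with i
            exact hC i x
  exact ⟨⟨f, contDiff_infty.2 fun k => hcont k f hf, fun k m => hdecay m f hf k⟩, rfl⟩

end Family

/-- The matrix coefficient `g ↦ ∫ [Λ(0,g) w](p) ψ(p) dp`, as a function. -/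
def coefFun (ħ : ℝ) (w ψ : 𝓢(Phase n, ℂ)) : Phase n → ℂ := fun g =>
  ∫ p, twist ħ g (-g) w p * ψ p

/-- The substitution p = h + g leaves the phase unchanged because g ∧ g = 0. In this form g enters
only through a phase and a translate of ψ, so w alone dominates the integrand. -/
theorem coefFun_eq_integral (ħ : ℝ) (w ψ : 𝓢(Phase n, ℂ)) (g : Phase n) :
    coefFun ħ w ψ g = ∫ h, phaseFactor ħ (symp n g) h * w h * ψ (h + g) := by
  rw [coefFun, ← integral_add_right_eq_self _ g]
  congr 1
  ext h
  simp [phaseFactor]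

theorem integrable_coefFun_integrand (ħ : ℝ) (w ψ : 𝓢(Phase n, ℂ)) (g : Phase n) :
    Integrable (fun h => phaseFactor ħ (symp n g) h * w h * ψ (h + g)) := by
  simpa using integrable_mul_schwartz (twist ħ g 0 w) (twist ħ 0 g ψ)

theorem norm_coefFun_le (ħ : ℝ) (w ψ : 𝓢(Phase n, ℂ)) :
    ∃ C, ∀ g, ‖coefFun ħ w ψ g‖ ≤ C := by
  refine ⟨∫ h, ‖w h‖ * SchwartzMap.seminorm ℝ 0 0 ψ, fun g => ?_⟩
  rw [coefFun_eq_integral]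
  refine norm_integral_le_of_norm_le ((w.integrable (μ := volume)).norm.mul_const _)
    (Filter.Eventually.of_forall fun h => ?_)
  simp only [norm_mul, norm_phaseFactor, one_mul]
  gcongr
  exact norm_le_seminorm ℝ ψ _

theorem coefFun_add_left (ħ : ℝ) (w w' ψ : 𝓢(Phase n, ℂ)) (g : Phase n) :
    coefFun ħ (w + w') ψ g = coefFun ħ w ψ g + coefFun ħ w' ψ g := by
  simp only [coefFun, map_add, add_apply, add_mul]
  exact integral_add (integrable_mul_schwartz _ _) (integrable_mul_schwartz _ _)

theorem coefFun_add_right (ħ : ℝ) (w ψ ψ' : 𝓢(Phase n, ℂ)) (g : Phase n) :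
    coefFun ħ w (ψ + ψ') g = coefFun ħ w ψ g + coefFun ħ w ψ' g := by
  simp only [coefFun, add_apply, mul_add]
  exact integral_add (integrable_mul_schwartz _ _) (integrable_mul_schwartz _ _)

theorem coefFun_smul_left (ħ : ℝ) (c : ℂ) (w ψ : 𝓢(Phase n, ℂ)) (g : Phase n) :
    coefFun ħ (c • w) ψ g = c * coefFun ħ w ψ g := by
  simp only [coefFun, map_smul, smul_apply, smul_eq_mul, mul_assoc]
  exact integral_const_mul _ _

theorem coefFun_smul_right (ħ : ℝ) (c : ℂ) (w ψ : 𝓢(Phase n, ℂ)) (g : Phase n) :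
    coefFun ħ w (c • ψ) g = c * coefFun ħ w ψ g := by
  simp only [coefFun, smul_apply, smul_eq_mul, mul_left_comm _ c]
  exact integral_const_mul _ _

/-- This is ℓ(g) = ℓ(h + g) - ℓ(h) under the integral. -/
theorem linMul_coefFun (ħ : ℝ) (w ψ : 𝓢(Phase n, ℂ)) (ℓ : Phase n →L[ℝ] ℝ) (g : Phase n) :
    (ℓ g : ℂ) * coefFun ħ w ψ g = coefFun ħ w (linMul ℓ ψ) g - coefFun ħ (linMul ℓ w) ψ g := by
  simp only [coefFun_eq_integral]
  rw [← integral_const_mul, ← integral_sub (integrable_coefFun_integrand _ _ _ _)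
    (integrable_coefFun_integrand _ _ _ _)]
  congr 1
  ext h
  simp
  ring

/-- Differentiation under the integral: the phase contributes a factor linear in h, which the decay
of w absorbs. The integrability of the derivative is recorded too, since the operator-valued
integral is later evaluated at a vector. -/
theorem hasFDerivAt_coefFun (ħ : ℝ) (w ψ : 𝓢(Phase n, ℂ)) (g : Phase n) :
    HasFDerivAt (coefFun ħ w ψ) (∫ h, (w h * phaseFactor ħ (symp n g) h) • fderiv ℝ ψ (h + g) +
      (ψ (h + g) * w h * (phaseFactor ħ (symp n g) h * (Real.pi * Complex.I * ħ))) •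
        (Complex.ofRealCLM ∘L (symp n).flip h)) g ∧
    Integrable (fun h => (w h * phaseFactor ħ (symp n g) h) • fderiv ℝ ψ (h + g) +
      (ψ (h + g) * w h * (phaseFactor ħ (symp n g) h * (Real.pi * Complex.I * ħ))) •
        (Complex.ofRealCLM ∘L (symp n).flip h)) := by
  have hrw : coefFun ħ w ψ = fun g => ∫ h, phaseFactor ħ (symp n g) h * w h * ψ (h + g) :=
    funext fun g => coefFun_eq_integral ħ w ψ g
  have hsw : ∀ g h : Phase n, phaseFactor ħ (symp n g) h = phaseFactor ħ ((symp n).flip h) g :=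
    fun g h => rfl
  have hphase : Continuous fun h : Phase n => phaseFactor ħ (symp n g) h :=
    continuous_phaseFactor ħ _
  obtain ⟨C, hC⟩ : ∃ C, ∀ x, ‖fderiv ℝ ψ x‖ ≤ C :=
    ⟨_, fun x => norm_le_seminorm ℝ (fderivCLM ℝ (Phase n) ℂ ψ) x⟩
  have hdc : Continuous (fderiv ℝ ψ) := (fderivCLM ℝ (Phase n) ℂ ψ).continuous
  set M := SchwartzMap.seminorm ℝ 0 0 ψ
  set B := ‖(symp n).flip‖
  have hmeas : AEStronglyMeasurable
      (fun h => (w h * phaseFactor ħ (symp n g) h) • fderiv ℝ ψ (h + g) +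
      (ψ (h + g) * w h * (phaseFactor ħ (symp n g) h * (Real.pi * Complex.I * ħ))) •
        (Complex.ofRealCLM ∘L (symp n).flip h)) (volume : Measure (Phase n)) := by
    refine Continuous.aestronglyMeasurable ?_
    have : Continuous fun h : Phase n => Complex.ofRealCLM ∘L (symp n).flip h :=
      continuous_const.clm_comp (symp n).flip.continuous
    fun_prop
  have hbound : ∀ h g' : Phase n, ‖(w h * phaseFactor ħ (symp n g') h) • fderiv ℝ ψ (h + g') +
      (ψ (h + g') * w h * (phaseFactor ħ (symp n g') h * (Real.pi * Complex.I * ħ))) •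
        (Complex.ofRealCLM ∘L (symp n).flip h)‖
        ≤ ‖w h‖ * C + M * |Real.pi * ħ| * B * (‖h‖ ^ 1 * ‖w h‖) := by
    intro h g'
    refine (norm_add_le _ _).trans (add_le_add ?_ ?_)
    · rw [norm_smul, norm_mul, norm_phaseFactor, mul_one]
      gcongr
      exact hC _
    · rw [norm_smul]
      have h1 : ‖Complex.ofRealCLM ∘L (symp n).flip h‖ ≤ B * ‖h‖ := by
        refine (ContinuousLinearMap.opNorm_comp_le _ _).trans ?_
        rw [Complex.ofRealCLM_norm, one_mul]
        exact (symp n).flip.le_opNorm h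
      have h2 : ‖ψ (h + g')‖ ≤ M := norm_le_seminorm ℝ ψ _
      calc ‖ψ (h + g') * w h * (phaseFactor ħ (symp n g') h * (Real.pi * Complex.I * ħ))‖
            * ‖Complex.ofRealCLM ∘L (symp n).flip h‖
          = ‖ψ (h + g')‖ * ‖w h‖ * |Real.pi * ħ| * ‖Complex.ofRealCLM ∘L (symp n).flip h‖ := by
            simp [abs_mul]
        _ ≤ M * ‖w h‖ * |Real.pi * ħ| * (B * ‖h‖) := by gcongr
        _ = _ := by ring
  have hint : Integrable (fun h => ‖w h‖ * C + M * |Real.pi * ħ| * B * (‖h‖ ^ 1 * ‖w h‖))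
      (volume : Measure (Phase n)) :=
    ((w.integrable (μ := volume)).norm.mul_const _).add
      ((w.integrable_pow_mul volume 1).const_mul _)
  refine ⟨?_, hint.mono' hmeas (Filter.Eventually.of_forall fun h => hbound h g)⟩
  rw [hrw]
  refine hasFDerivAt_integral_of_dominated_of_fderiv_le (s := Set.univ)
    (F' := fun g' h => (w h * phaseFactor ħ (symp n g') h) • fderiv ℝ ψ (h + g') +
      (ψ (h + g') * w h * (phaseFactor ħ (symp n g') h * (Real.pi * Complex.I * ħ))) •
        (Complex.ofRealCLM ∘L (symp n).flip h))
    (bound := fun h => ‖w h‖ * C + M * |Real.pi * ħ| * B * (‖h‖ ^ 1 * ‖w h‖))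
    Filter.univ_mem
    (Filter.Eventually.of_forall fun g' =>
      (integrable_coefFun_integrand ħ w ψ g').aestronglyMeasurable)
    (integrable_coefFun_integrand ħ w ψ g) hmeas
    (Filter.Eventually.of_forall fun h g' _ => hbound h g') hint
    (Filter.Eventually.of_forall fun h g' _ => ?_)
  have h1 := (hasFDerivAt_phaseFactor ħ ((symp n).flip h) g').mul_const (w h)
  have h2 : HasFDerivAt (fun g' => ψ (h + g')) (fderiv ℝ ψ (h + g')) g' :=
    (ψ.hasFDerivAt (h + g')).comp g' ((hasFDerivAt_id g').const_add h)
  convert! h1.mul h2 using 1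
  refine ContinuousLinearMap.ext fun v => ?_
  simp [hsw]
  ring

theorem fderiv_coefFun_apply (ħ : ℝ) (w ψ : 𝓢(Phase n, ℂ)) (g e : Phase n) :
    fderiv ℝ (coefFun ħ w ψ) g e = coefFun ħ w (∂_{e} ψ) g
      + Real.pi * Complex.I * ħ * coefFun ħ (linMul (symp n e) w) ψ g := by
  obtain ⟨h1, h2⟩ := hasFDerivAt_coefFun ħ w ψ g
  rw [h1.fderiv, ContinuousLinearMap.integral_apply h2, coefFun_eq_integral, coefFun_eq_integral,
    ← integral_const_mul, ← integral_add (integrable_coefFun_integrand _ _ _ _)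
      ((integrable_coefFun_integrand _ _ _ _).const_mul _)]
  congr 1
  ext h
  simp [lineDerivOp_apply_eq_fderiv]
  ring

theorem exists_coef (ħ : ℝ) (w ψ : 𝓢(Phase n, ℂ)) :
    ∃ c : 𝓢(Phase n, ℂ), (c : Phase n → ℂ) = coefFun ħ w ψ := by
  -- A derivative or a multiple by a linear form of one coefficient is a combination of two
  -- coefficients, so the closed family is the linear span.
  set G : Set (Phase n → ℂ) :=
    Set.range fun q : 𝓢(Phase n, ℂ) × 𝓢(Phase n, ℂ) => coefFun ħ q.1 q.2
  set V := Submodule.span ℂ G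
  have hG : ∀ w ψ : 𝓢(Phase n, ℂ), coefFun ħ w ψ ∈ V :=
    fun w ψ => Submodule.subset_span ⟨(w, ψ), rfl⟩
  have hdiff : ∀ f ∈ V, Differentiable ℝ f := by
    intro f hf
    induction hf using Submodule.span_induction with
    | mem f hf =>
      obtain ⟨q, rfl⟩ := hf
      exact fun g => (hasFDerivAt_coefFun ħ q.1 q.2 g).1.differentiableAt
    | zero => exact differentiable_const 0
    | add f f' _ _ h h' => exact h.add h'
    | smul c f _ h => exact h.const_smul c
  refine exists_schwartzMap_of_family (V : Set (Phase n → ℂ)) ?_ hdiff ?_ ?_ (hG w ψ)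
  · intro f hf
    induction hf using Submodule.span_induction with
    | mem f hf =>
      obtain ⟨q, rfl⟩ := hf
      exact norm_coefFun_le ħ q.1 q.2
    | zero => exact ⟨0, by simp⟩
    | add f f' _ _ h h' =>
      obtain ⟨C, hC⟩ := h
      obtain ⟨C', hC'⟩ := h'
      exact ⟨C + C', fun x => (norm_add_le _ _).trans (add_le_add (hC x) (hC' x))⟩
    | smul c f _ h =>
      obtain ⟨C, hC⟩ := h
      refine ⟨‖c‖ * C, fun x => ?_⟩
      rw [Pi.smul_apply, norm_smul]
      gcongr
      exact hC x
  · intro f hf e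
    induction hf using Submodule.span_induction with
    | mem f hf =>
      obtain ⟨q, rfl⟩ := hf
      have : (fun x => fderiv ℝ (coefFun ħ q.1 q.2) x e) = coefFun ħ q.1 (∂_{e} q.2)
          + (Real.pi * Complex.I * ħ : ℂ) • coefFun ħ (linMul (symp n e) q.1) q.2 :=
        funext fun x => fderiv_coefFun_apply ħ q.1 q.2 x e
      change (fun x => fderiv ℝ (coefFun ħ q.1 q.2) x e) ∈ V
      rw [this]
      exact V.add_mem (hG _ _) (V.smul_mem _ (hG _ _))
    | zero =>
      convert! V.zero_mem using 1
      ext x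
      simp
    | add f f' hf hf' h h' =>
      convert! V.add_mem h h' using 1
      ext x
      simp [fderiv_add (hdiff f hf x) (hdiff f' hf' x)]
    | smul c f hf h =>
      convert! V.smul_mem c h using 1
      ext x
      simp [fderiv_const_smul (hdiff f hf x)]
  · intro f hf ℓ
    induction hf using Submodule.span_induction with
    | mem f hf =>
      obtain ⟨q, rfl⟩ := hf
      have : (fun x => (ℓ x : ℂ) * coefFun ħ q.1 q.2 x)
          = coefFun ħ q.1 (linMul ℓ q.2) - coefFun ħ (linMul ℓ q.1) q.2 :=
        funext fun x => linMul_coefFun ħ q.1 q.2 ℓ x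
      change (fun x => (ℓ x : ℂ) * coefFun ħ q.1 q.2 x) ∈ V
      rw [this]
      exact V.sub_mem (hG _ _) (hG _ _)
    | zero =>
      convert! V.zero_mem using 1
      ext x
      simp
    | add f f' hf hf' h h' =>
      convert! V.add_mem h h' using 1
      ext x
      simp [mul_add]
    | smul c f hf h =>
      convert! V.smul_mem c h using 1
      ext x
      simp [mul_left_comm]

/-- The matrix coefficient `g ↦ ∫ [Λ(0,g) w](p) ψ(p) dp`, as a Schwartz function. -/
def coef (ħ : ℝ) (w ψ : 𝓢(Phase n, ℂ)) : 𝓢(Phase n, ℂ) := (exists_coef ħ w ψ).choose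

theorem coef_apply (ħ : ℝ) (w ψ : 𝓢(Phase n, ℂ)) (g : Phase n) :
    coef ħ w ψ g = coefFun ħ w ψ g :=
  congrFun (exists_coef ħ w ψ).choose_spec g

theorem coef_add_left (ħ : ℝ) (w w' ψ : 𝓢(Phase n, ℂ)) :
    coef ħ (w + w') ψ = coef ħ w ψ + coef ħ w' ψ := by
  ext g
  simp [coef_apply, coefFun_add_left]

theorem coef_smul_left (ħ : ℝ) (c : ℂ) (w ψ : 𝓢(Phase n, ℂ)) :
    coef ħ (c • w) ψ = c • coef ħ w ψ := by
  ext g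
  simp [coef_apply, coefFun_smul_left]

/-- Transposition moves the operator from ψ onto Λ(g)w, and it passes through Λ(g) because the two
actions commute. -/
theorem coef_derL_right (ħ : ℝ) (e : Phase n) (w ψ : 𝓢(Phase n, ℂ)) :
    coef ħ w (derL ħ e ψ) = coef ħ (derR ħ e w) ψ := by
  ext g
  rw [coef_apply, coef_apply, coefFun, coefFun, ← integral_derR_mul]
  simp_rw [derR_twist_neg]

/-- The product and derivative rules give coef(w, L ψ) - 2πiħ coef((e ∧ ·)w, ψ) with L = `derL ħ e`.
Moving L onto w turns it into `derR ħ e`, and subtracting twice the multiplication term gives -L w.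
The sign disappears for even powers. -/
theorem derL_coef (ħ : ℝ) (e : Phase n) (w ψ : 𝓢(Phase n, ℂ)) :
    derL ħ e (coef ħ w ψ) = -coef ħ (derL ħ e w) ψ := by
  ext g
  have h0 : (coef ħ w ψ : Phase n → ℂ) = coefFun ħ w ψ := funext (coef_apply ħ w ψ)
  have hneg : ∀ v : 𝓢(Phase n, ℂ), coefFun ħ (-v) ψ g = -coefFun ħ v ψ g := fun v => by
    rw [← neg_one_smul ℂ v, coefFun_smul_left, neg_one_mul]
  have hneg' : ∀ v : 𝓢(Phase n, ℂ), coefFun ħ w (-v) g = -coefFun ħ w v g := fun v => by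
    rw [← neg_one_smul ℂ v, coefFun_smul_right, neg_one_mul]
  have hR : coefFun ħ w (derL ħ e ψ) g = coefFun ħ (derR ħ e w) ψ g := by
    rw [← coef_apply, ← coef_apply, coef_derL_right]
  have h1 := linMul_coefFun ħ w ψ (symp n e) g
  rw [derL_apply, h0, fderiv_coefFun_apply, h1, neg_apply, coef_apply]
  simp only [derL, derR, add_apply, neg_apply, smul_apply, lineDerivOpCLM_apply, coefFun_add_left,
    coefFun_add_right, coefFun_smul_left, coefFun_smul_right, hneg, hneg'] at hR ⊢
  linear_combination hR

/-! ### The right pulled action on square integrable functions -/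

/-- The inclusion of the Schwartz space into `L²(ℝ²ⁿ)`. -/
def toL2 : 𝓢(Phase n, ℂ) →L[ℂ] L2Phase n := toLpCLM ℂ ℂ 2 (volume : Measure (Phase n))

theorem toLp_eq_toL2 (u : 𝓢(Phase n, ℂ)) : u.toLp 2 (volume : Measure (Phase n)) = toL2 u := rfl

theorem coeFn_toL2 (u : 𝓢(Phase n, ℂ)) : toL2 u =ᵐ[volume] u :=
  u.coeFn_toLp 2 (volume : Measure (Phase n))

theorem denseRange_toL2 : DenseRange (toL2 : 𝓢(Phase n, ℂ) → L2Phase n) :=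
  denseRange_toLpCLM (F := ℂ) (p := 2) (μ := (volume : Measure (Phase n))) ENNReal.ofNat_ne_top

theorem norm_toL2_twist (ħ : ℝ) (a b : Phase n) (u : 𝓢(Phase n, ℂ)) :
    ‖toL2 (twist ħ a b u)‖ = ‖toL2 u‖ := by
  rw [← toLp_eq_toL2, ← toLp_eq_toL2, norm_toLp' (by norm_num) (by norm_num),
    norm_toLp' (by norm_num) (by norm_num)]
  congr 1
  rw [← integral_add_right_eq_self (fun p => ‖u p‖ ^ (2 : ENNReal).toReal) b]
  simp

attribute [irreducible] toL2

/-- The right pulled action of `(0, h)` on `L²(ℝ²ⁿ)`. -/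
def rightOp (ħ : ℝ) (h : Phase n) : L2Phase n →L[ℂ] L2Phase n :=
  (toL2.toLinearMap ∘ₗ (twist ħ h h).toLinearMap).extendOfNorm toL2.toLinearMap

theorem rightOp_toL2 (ħ : ℝ) (h : Phase n) (u : 𝓢(Phase n, ℂ)) :
    rightOp ħ h (toL2 u) = toL2 (twist ħ h h u) :=
  LinearMap.extendOfNorm_eq (e := toL2.toLinearMap) denseRange_toL2
    ⟨1, fun u => by rw [one_mul]; exact (norm_toL2_twist ħ h h u).le⟩ u

attribute [irreducible] rightOp

theorem norm_rightOp (ħ : ℝ) (h : Phase n) (a : L2Phase n) : ‖rightOp ħ h a‖ = ‖a‖ := by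
  induction a using DenseRange.induction_on denseRange_toL2 with
  | hp => exact isClosed_eq (rightOp ħ h).continuous.norm continuous_norm
  | ih u => rw [rightOp_toL2, norm_toL2_twist]

theorem inner_rightOp_rightOp (ħ : ℝ) (h : Phase n) (a b : L2Phase n) :
    inner ℂ (rightOp ħ h a) (rightOp ħ h b) = inner ℂ a b :=
  LinearIsometry.inner_map_map
    ⟨(rightOp ħ h).toLinearMap, norm_rightOp ħ h⟩ a b

theorem twist_neg_twist (ħ : ℝ) (h : Phase n) (u : 𝓢(Phase n, ℂ)) :
    twist ħ h h (twist ħ (-h) (-h) u) = u := by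
  ext p
  simp only [twist_apply, phaseFactor, ← mul_assoc, ← Complex.exp_add]
  simp

theorem toDist_apply (a : L2Phase n) (ψ : 𝓢(Phase n, ℂ)) : toDist a ψ = ∫ p, ψ p * a p := by
  simp [toDist]

theorem toDist_toL2 (u ψ : 𝓢(Phase n, ℂ)) :
    toDist (toL2 u) ψ = ∫ p, ψ p * u p := by
  rw [toDist_apply]
  refine integral_congr_ae ?_
  filter_upwards [coeFn_toL2 u] with p hp
  rw [hp]

/-- Evaluation of square integrable functions at a Schwartz function. -/
def toDistCLM (ψ : 𝓢(Phase n, ℂ)) : L2Phase n →L[ℂ] ℂ :=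
  (PointwiseConvergenceCLM.evalCLM (RingHom.id ℂ) ℂ ψ).comp
    (Lp.toTemperedDistributionCLM ℂ (volume : Measure (Phase n)) 2)

@[simp]
theorem toDistCLM_apply (ψ : 𝓢(Phase n, ℂ)) (a : L2Phase n) : toDistCLM ψ a = toDist a ψ := rfl

theorem toDist_injective : Function.Injective (toDist : L2Phase n → 𝓢'(Phase n, ℂ)) :=
  LinearMap.ker_eq_bot.1
    (Lp.ker_toTemperedDistributionCLM_eq_bot (F := ℂ) (p := 2) (μ := (volume : Measure (Phase n))))

theorem toDist_ext {a b : L2Phase n} (h : ∀ ψ, toDist a ψ = toDist b ψ) : a = b :=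
  toDist_injective (by ext ψ; exact h ψ)

/-- Pointwise complex conjugation of a Schwartz function. -/
def conjS {E : Type*} [NormedAddCommGroup E] [NormedSpace ℝ E] (u : 𝓢(E, ℂ)) : 𝓢(E, ℂ) :=
  u.postcompCLM (𝕜 := ℝ) (Complex.conjCLE : ℂ →L[ℝ] ℂ)

@[simp]
theorem conjS_apply {E : Type*} [NormedAddCommGroup E] [NormedSpace ℝ E] (u : 𝓢(E, ℂ)) (p : E) :
    conjS u p = conj (u p) := rfl

@[simp]
theorem conjS_conjS (u : 𝓢(Phase n, ℂ)) : conjS (conjS u) = u := by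
  ext p
  simp

theorem toDist_conjS (a : L2Phase n) (v : 𝓢(Phase n, ℂ)) :
    toDist a (conjS v) = inner ℂ (toL2 v) a := by
  rw [toDist_apply, L2.inner_def]
  refine integral_congr_ae ?_
  filter_upwards [coeFn_toL2 v] with p hp
  rw [hp]
  simp [mul_comm]

/-- Expresses that `derR` is skew-adjoint for the inner product, with `derL` as its bilinear
transpose. -/
theorem derL_conjS (ħ : ℝ) (e : Phase n) (v : 𝓢(Phase n, ℂ)) :
    derL ħ e (conjS v) = -conjS (derR ħ e v) := by
  ext p
  have h : fderiv ℝ (conjS v) p e = conj (fderiv ℝ v p e) := by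
    have := (Complex.conjCLE : ℂ →L[ℝ] ℂ).hasFDerivAt.comp p (v.hasFDerivAt p)
    rw [show (conjS v : Phase n → ℂ) = (Complex.conjCLE : ℂ →L[ℝ] ℂ) ∘ v from rfl, this.fderiv]
    simp
  rw [neg_apply, conjS_apply, derL_apply, derR_apply, h]
  simp
  ring

/-! ### Strong differentiability of the right pulled action -/

theorem hasDerivAt_twist_apply (ħ : ℝ) (h : Phase n) (u : 𝓢(Phase n, ℂ)) (p : Phase n) (t : ℝ) :
    HasDerivAt (fun t : ℝ => twist ħ (t • h) (t • h) u p)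
      (twist ħ (t • h) (t • h) (derR ħ h u) p) t := by
  have h1 : HasDerivAt (fun t : ℝ => ((Real.pi * ħ * (t * symp n h p) : ℝ) : ℂ) * Complex.I)
      (((Real.pi * ħ * (1 * symp n h p) : ℝ) : ℂ) * Complex.I) t :=
    (HasDerivAt.ofReal_comp (((hasDerivAt_id t).mul_const _).const_mul _)).mul_const _
  have h2 : HasDerivAt (fun t : ℝ => u (p + t • h)) (fderiv ℝ u (p + t • h) h) t := by
    have := (u.hasFDerivAt (p + t • h)).comp_hasDerivAt t
      (((hasDerivAt_id t).smul_const h).const_add p)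
    simpa using! this
  have h3 := h1.cexp.mul h2
  have e1 : (fun t : ℝ => twist ħ (t • h) (t • h) u p) = fun t : ℝ =>
      Complex.exp (((Real.pi * ħ * (t * symp n h p) : ℝ) : ℂ) * Complex.I) * u (p + t • h) := by
    funext t
    simp [phaseFactor]
  rw [e1]
  convert! h3 using 1
  simp [phaseFactor, derR_apply]
  ring

/-- A decreasing weight in `L²` which dominates all Schwartz functions. -/
theorem exists_weight (n : ℕ) : ∃ (K : ℕ) (m : Lp ℝ 2 (volume : Measure (Phase n))),
    m =ᵐ[volume] fun p => (1 + ‖p‖) ^ (-K : ℝ) := by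
  obtain ⟨K, hK⟩ := Measure.HasTemperateGrowth.exists_eLpNorm_lt_top (E := Phase n) 2
    (μ := volume) inferInstance
  have hm : MemLp (fun p : Phase n => (1 + ‖p‖) ^ (-K : ℝ)) 2 volume := by
    refine ⟨Continuous.aestronglyMeasurable ?_, hK⟩
    exact .rpow_const (by fun_prop) fun p => .inl (by positivity)
  exact ⟨K, hm.toLp, hm.coeFn_toLp⟩

/-- For ‖q‖ ≤ r one has 1 + ‖p‖ ≤ (1 + r)(1 + ‖p + q‖), so translation by bounded vectors costs only
a constant in the decay estimate. -/
theorem norm_schwartz_translate_le (K : ℕ) (u : 𝓢(Phase n, ℂ)) (r : ℝ) :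
    ∃ C, ∀ p q : Phase n, ‖q‖ ≤ r → ‖u (p + q)‖ ≤ C * (1 + ‖p‖) ^ (-K : ℝ) := by
  set C₀ := 2 ^ K * ((Finset.Iic (K, 0)).sup fun m => SchwartzMap.seminorm ℝ m.1 m.2) u
  refine ⟨(1 + r) ^ K * C₀, fun p q hq => ?_⟩
  have h1 : (1 + ‖p + q‖) ^ K * ‖u (p + q)‖ ≤ C₀ := by
    simpa using one_add_le_sup_seminorm_apply (𝕜 := ℝ) (m := (K, 0)) (le_refl K) (le_refl 0) u
      (p + q)
  have h2 : 1 + ‖p‖ ≤ (1 + r) * (1 + ‖p + q‖) := by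
    have h3 : ‖p‖ ≤ ‖p + q‖ + ‖q‖ := by simpa using norm_sub_le (p + q) q
    nlinarith [norm_nonneg (p + q), norm_nonneg q]
  have hr : 0 ≤ r := (norm_nonneg q).trans hq
  rw [Real.rpow_neg (by positivity), Real.rpow_natCast, ← div_eq_mul_inv, le_div_iff₀ (by positivity)]
  calc ‖u (p + q)‖ * (1 + ‖p‖) ^ K ≤ ‖u (p + q)‖ * ((1 + r) * (1 + ‖p + q‖)) ^ K := by gcongr
    _ = (1 + r) ^ K * ((1 + ‖p + q‖) ^ K * ‖u (p + q)‖) := by rw [mul_pow]; ring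
    _ ≤ (1 + r) ^ K * C₀ := by gcongr

/-- The mean value inequality is used twice: first for the derivative, then for the function minus
its linear approximation. -/
theorem norm_sub_sub_smul_le_of_hasDerivAt {g g' g'' : ℝ → ℂ} (hg : ∀ t, HasDerivAt g (g' t) t)
    (hg' : ∀ t, HasDerivAt g' (g'' t) t) {s t M : ℝ}
    (hM : ∀ r, |r - t| ≤ |s - t| → ‖g'' r‖ ≤ M) :
    ‖g s - g t - (s - t) • g' t‖ ≤ M * |s - t| ^ 2 := by
  set S := Metric.closedBall t |s - t|
  have htS : t ∈ S := Metric.mem_closedBall_self (abs_nonneg _)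
  have hsS : s ∈ S := by simp [S, Real.dist_eq]
  have hS : Convex ℝ S := convex_closedBall _ _
  have hSb : ∀ r ∈ S, |r - t| ≤ |s - t| := fun r hr => by
    simpa [S, Real.dist_eq] using hr
  have hM0 : 0 ≤ M := (norm_nonneg _).trans (hM t (hSb t htS))
  have h1 : ∀ r ∈ S, ‖g' r - (1 : ℝ) • g' t‖ ≤ M * |s - t| := by
    intro r hr
    rw [one_smul]
    refine (hS.norm_image_sub_le_of_norm_hasDerivWithin_le
      (fun x _ => (hg' x).hasDerivWithinAt) (fun x hx => hM x (hSb x hx)) htS hr).trans ?_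
    exact mul_le_mul_of_nonneg_left (hSb r hr) hM0
  have h0 := hS.norm_image_sub_le_of_norm_hasDerivWithin_le
    (f := fun r : ℝ => g r - (r - t) • g' t) (f' := fun r : ℝ => g' r - (1 : ℝ) • g' t)
    (fun x _ => ((hg x).sub (((hasDerivAt_id x).sub_const t).smul_const _)).hasDerivWithinAt)
    h1 htS hsS
  calc ‖g s - g t - (s - t) • g' t‖ = ‖g s - (s - t) • g' t - (g t - (t - t) • g' t)‖ := by
        congr 1
        rw [sub_self, zero_smul]
        ring
    _ ≤ M * |s - t| * ‖s - t‖ := h0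
    _ = M * |s - t| ^ 2 := by
        rw [Real.norm_eq_abs]
        ring

theorem norm_toL2_le_of_norm_le {K : ℕ} {m : Lp ℝ 2 (volume : Measure (Phase n))}
    (hm : m =ᵐ[volume] fun p => (1 + ‖p‖) ^ (-K : ℝ)) {C : ℝ} {v : 𝓢(Phase n, ℂ)}
    (hv : ∀ p, ‖v p‖ ≤ C * (1 + ‖p‖) ^ (-K : ℝ)) : ‖toL2 v‖ ≤ C * ‖m‖ := by
  refine Lp.norm_le_mul_norm_of_ae_le_mul ?_
  filter_upwards [hm, coeFn_toL2 v] with p h0 h1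
  rw [h0, h1, Real.norm_of_nonneg (by positivity)]
  exact hv p

/-- The second order Taylor remainder is estimated at each point p. Its bound decays in p uniformly
for s near t, so it is dominated by one L² weight. -/
theorem exists_norm_toL2_twist_sub_le (ħ : ℝ) (h : Phase n) (u : 𝓢(Phase n, ℂ)) (t : ℝ) :
    ∃ C, ∀ s : ℝ, |s - t| ≤ 1 → ‖toL2 (twist ħ (s • h) (s • h) u)
      - toL2 (twist ħ (t • h) (t • h) u)
      - (s - t) • toL2 (twist ħ (t • h) (t • h) (derR ħ h u))‖ ≤ C * |s - t| ^ 2 := by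
  obtain ⟨K, m, hm⟩ := exists_weight n
  -- The radius covers all translations r h with r between s and t, since |s - t| ≤ 1 gives |r| ≤
  -- |t| + 1.
  obtain ⟨C, hC⟩ := norm_schwartz_translate_le K (derR ħ h (derR ħ h u)) ((|t| + 1) * ‖h‖)
  refine ⟨C * ‖m‖, fun s hs => ?_⟩
  set v : 𝓢(Phase n, ℂ) := twist ħ (s • h) (s • h) u - twist ħ (t • h) (t • h) u
    - (s - t) • twist ħ (t • h) (t • h) (derR ħ h u) with hv
  have h1 : toL2 (twist ħ (s • h) (s • h) u) - toL2 (twist ħ (t • h) (t • h) u)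
      - (s - t) • toL2 (twist ħ (t • h) (t • h) (derR ħ h u)) = toL2 v := by
    rw [hv, map_sub, map_sub, toL2.map_smul_of_tower]
  rw [h1, mul_right_comm]
  refine norm_toL2_le_of_norm_le hm fun p => ?_
  have h2 := norm_sub_sub_smul_le_of_hasDerivAt (s := s) (t := t)
    (M := C * (1 + ‖p‖) ^ (-K : ℝ))
    (fun t => hasDerivAt_twist_apply ħ h u p t)
    (fun t => hasDerivAt_twist_apply ħ h (derR ħ h u) p t) ?_
  · refine (le_of_eq ?_).trans (h2.trans (le_of_eq (by ring)))
    simp [hv]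
  · intro r hr
    rw [twist_apply, norm_mul, norm_phaseFactor, one_mul]
    refine hC p (r • h) ?_
    rw [norm_smul, Real.norm_eq_abs]
    gcongr
    have := abs_sub_abs_le_abs_sub r t
    linarith

theorem hasDerivAt_toL2_twist (ħ : ℝ) (h : Phase n) (u : 𝓢(Phase n, ℂ)) (t : ℝ) :
    HasDerivAt (fun t : ℝ => toL2 (twist ħ (t • h) (t • h) u))
      (toL2 (twist ħ (t • h) (t • h) (derR ħ h u))) t := by
  obtain ⟨C, hC⟩ := exists_norm_toL2_twist_sub_le ħ h u t
  rw [hasDerivAt_iff_isLittleO]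
  refine Asymptotics.IsBigO.trans_isLittleO (g := fun s : ℝ => ‖s - t‖ ^ 2) ?_
    (Asymptotics.isLittleO_pow_sub_sub t one_lt_two)
  refine Asymptotics.IsBigO.of_bound C ?_
  filter_upwards [Metric.closedBall_mem_nhds t one_pos] with s hs
  rw [Metric.mem_closedBall, Real.dist_eq] at hs
  simpa using hC s hs

/-- Mean value inequality along t ↦ R(th)u on [0,1]; its velocity has constant norm because R(th) is
isometric. -/
theorem norm_rightOp_sub_le (ħ : ℝ) (h : Phase n) (u : 𝓢(Phase n, ℂ)) :
    ‖rightOp ħ h (toL2 u) - toL2 u‖ ≤ ‖toL2 (derR ħ h u)‖ := by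
  have h1 := (convex_univ (𝕜 := ℝ)).norm_image_sub_le_of_norm_hasDerivWithin_le
    (fun t _ => (hasDerivAt_toL2_twist ħ h u t).hasDerivWithinAt)
    (fun t _ => (norm_toL2_twist ħ _ _ _).le) (Set.mem_univ (0 : ℝ)) (Set.mem_univ (1 : ℝ))
  have h2 : twist ħ (0 : Phase n) 0 u = u := by
    ext p
    simp
  simpa [rightOp_toL2, h2] using h1

theorem derR_add (ħ : ℝ) (e e' : Phase n) : derR ħ (e + e') = derR ħ e + derR ħ e' := by
  ext u p
  simp [derR_apply]
  ring

theorem derR_smul (ħ : ℝ) (c : ℝ) (e : Phase n) : derR ħ (c • e) = (c : ℂ) • derR ħ e := by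
  ext u p
  simp [derR_apply]
  ring

theorem derL_add (ħ : ℝ) (e e' : Phase n) : derL ħ (e + e') = derL ħ e + derL ħ e' := by
  ext u p
  simp [derL_apply]
  ring

theorem derL_smul (ħ : ℝ) (c : ℝ) (e : Phase n) : derL ħ (c • e) = (c : ℂ) • derL ħ e := by
  ext u p
  simp [derL_apply]
  ring

/-- The bound ‖`derR ħ k u`‖ is the norm of a linear map of k on a finite dimensional space, so it
tends to zero. -/
theorem tendsto_rightOp_toL2 (ħ : ℝ) (u : 𝓢(Phase n, ℂ)) :
    Filter.Tendsto (fun k => rightOp ħ k (toL2 u)) (nhds 0) (nhds (toL2 u)) := by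
  let l : Phase n →ₗ[ℝ] L2Phase n :=
    { toFun := fun h => toL2 (derR ħ h u)
      map_add' := fun e e' => by rw [derR_add, add_apply, map_add]
      map_smul' := fun c e => by
        rw [derR_smul, smul_apply, map_smul]
        rfl }
  rw [tendsto_iff_norm_sub_tendsto_zero]
  have hl0 : Filter.Tendsto (fun k => ‖l k‖) (nhds 0) (nhds 0) := by
    simpa using (l.continuous_of_finiteDimensional.norm.tendsto 0)
  exact squeeze_zero (fun _ => norm_nonneg _) (fun k => norm_rightOp_sub_le ħ k u) hl0

/-- The action of the elements (0,h) is multiplicative up to a central phase. This transfers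
continuity at 0 to continuity at every point. -/
theorem rightOp_eq_smul_rightOp_rightOp (ħ : ℝ) (h₀ h : Phase n) (u : 𝓢(Phase n, ℂ)) :
    rightOp ħ h (toL2 u)
      = phaseFactor ħ (symp n h₀) (h - h₀) • rightOp ħ h₀ (rightOp ħ (h - h₀) (toL2 u)) := by
  have : twist ħ h h u = phaseFactor ħ (symp n h₀) (h - h₀) •
      twist ħ h₀ h₀ (twist ħ (h - h₀) (h - h₀) u) := by
    ext p
    simp only [twist_apply, smul_apply, smul_eq_mul, ← mul_assoc, phaseFactor, ← Complex.exp_add]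
    congr 1
    · congr 1
      simp only [map_add, map_sub, sub_apply, symp_self, symp_swap h h₀]
      push_cast
      ring
    · congr 1
      abel
  rw [rightOp_toL2, rightOp_toL2, rightOp_toL2, this, map_smul]

theorem continuous_rightOp_toL2 (ħ : ℝ) (u : 𝓢(Phase n, ℂ)) :
    Continuous fun h => rightOp ħ h (toL2 u) := by
  rw [continuous_iff_continuousAt]
  intro h₀
  have h2 : Filter.Tendsto (phaseFactor ħ (symp n h₀)) (nhds 0) (nhds 1) := by
    have := (continuous_phaseFactor ħ (symp n h₀)).tendsto 0
    simpa [phaseFactor] using this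
  have h1 : Filter.Tendsto (fun k => phaseFactor ħ (symp n h₀) k •
      rightOp ħ h₀ (rightOp ħ k (toL2 u))) (nhds 0) (nhds ((1 : ℂ) • rightOp ħ h₀ (toL2 u))) :=
    h2.smul (((rightOp ħ h₀).continuous.tendsto _).comp (tendsto_rightOp_toL2 ħ u))
  rw [one_smul] at h1
  have h4 : Filter.Tendsto (fun h => h - h₀) (nhds h₀) (nhds 0) := by
    have := (continuous_id.sub (continuous_const (y := h₀))).tendsto h₀
    simpa using! this
  exact (h1.comp h4).congr fun h => (rightOp_eq_smul_rightOp_rightOp ħ h₀ h u).symm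

theorem continuous_rightOp (ħ : ℝ) (a : L2Phase n) : Continuous fun h => rightOp ħ h a := by
  rw [Metric.continuous_iff]
  intro h₀ ε hε
  obtain ⟨u, hu⟩ := Metric.denseRange_iff.1 (denseRange_toL2 (n := n)) a (ε / 3) (by positivity)
  obtain ⟨δ, hδ, hδ'⟩ := Metric.continuous_iff.1 (continuous_rightOp_toL2 ħ u) h₀ (ε / 3) (by positivity)
  refine ⟨δ, hδ, fun h hh => ?_⟩
  have hiso : ∀ h, dist (rightOp ħ h a) (rightOp ħ h (toL2 u)) < ε / 3 := fun h => by
    rwa [dist_eq_norm, ← map_sub, norm_rightOp, ← dist_eq_norm]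
  calc dist (rightOp ħ h a) (rightOp ħ h₀ a)
      ≤ dist (rightOp ħ h a) (rightOp ħ h (toL2 u))
        + dist (rightOp ħ h (toL2 u)) (rightOp ħ h₀ (toL2 u))
        + dist (rightOp ħ h₀ (toL2 u)) (rightOp ħ h₀ a) := dist_triangle4 _ _ _ _
    _ < ε / 3 + ε / 3 + ε / 3 := by
        have h1 := hiso h
        have h2 := hδ' h hh
        have h3 := hiso h₀
        rw [dist_comm] at h3
        exact add_lt_add (add_lt_add h1 h2) h3
    _ = ε := by ring

/-! ### Operators commuting with the derived right pulled action -/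

/-- An operator which commutes with the derived right pulled action. -/
def CommutesWithDerR (ħ : ℝ) (A : L2Phase n →L[ℂ] L2Phase n) : Prop :=
  ∀ (e : Phase n) (u ψ : 𝓢(Phase n, ℂ)),
    toDist (A (toL2 (derR ħ e u))) ψ = toDist (A (toL2 u)) (derL ħ e ψ)

/-- The matrix element ⟨A R(th)u, R(th)v⟩ has zero derivative, because A commutes weakly with the
skew-adjoint generator. Comparing t = 0 and t = 1 and using the unitarity of R(h) gives the
commutation on Schwartz functions, and density extends it. -/
theorem CommutesWithDerR.rightOp_apply {ħ : ℝ} {A : L2Phase n →L[ℂ] L2Phase n}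
    (hA : CommutesWithDerR ħ A) (h : Phase n) (a : L2Phase n) :
    A (rightOp ħ h a) = rightOp ħ h (A a) := by
  have hinf : ∀ u v : 𝓢(Phase n, ℂ), inner ℂ (toL2 v) (A (toL2 (derR ħ h u)))
      + inner ℂ (toL2 (derR ħ h v)) (A (toL2 u)) = 0 := by
    intro u v
    rw [← toDist_conjS, ← toDist_conjS, hA, derL_conjS, map_neg, neg_add_cancel]
  have hconst : ∀ u v : 𝓢(Phase n, ℂ),
      inner ℂ (toL2 (twist ħ h h v)) (A (toL2 (twist ħ h h u)))
        = inner ℂ (toL2 v) (A (toL2 u)) := by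
    intro u v
    have hder : ∀ t : ℝ, HasDerivAt (fun t : ℝ =>
        inner ℂ (toL2 (twist ħ (t • h) (t • h) v))
          (A (toL2 (twist ħ (t • h) (t • h) u)))) 0 t := by
      intro t
      have h1 := hasDerivAt_toL2_twist ħ h v t
      have h2 := ((A.restrictScalars ℝ).hasFDerivAt).comp_hasDerivAt t
        (hasDerivAt_toL2_twist ħ h u t)
      have h3 := h1.inner ℂ h2
      -- R(th) commutes with its own generator, as h ∧ h = 0.
      have hcomm : ∀ w : 𝓢(Phase n, ℂ), twist ħ (t • h) (t • h) (derR ħ h w) =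
          derR ħ h (twist ħ (t • h) (t • h) w) := by
        intro w
        ext p
        rw [derR_apply, (hasFDerivAt_twist ħ _ _ w p).fderiv, twist_apply, twist_apply, derR_apply]
        simp
        ring
      convert! h3 using 1
      have := hinf (twist ħ (t • h) (t • h) u) (twist ħ (t • h) (t • h) v)
      rw [← hcomm, ← hcomm] at this
      exact this.symm
    have hc := is_const_of_deriv_eq_zero (fun t => (hder t).differentiableAt)
      (fun t => (hder t).deriv) 1 0
    have h0 : ∀ w : 𝓢(Phase n, ℂ), twist ħ (0 : Phase n) 0 w = w := by
      intro w
      ext p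
      simp
    simpa [h0] using hc
  induction a using DenseRange.induction_on denseRange_toL2 with
  | hp =>
    exact isClosed_eq (A.continuous.comp (rightOp ħ h).continuous)
      ((rightOp ħ h).continuous.comp A.continuous)
  | ih u =>
    refine toDist_ext fun ψ => ?_
    -- The second vector is R(-h) applied to the conjugate of ψ, so that R(h) returns the arbitrary
    -- test function.
    have h1 := hconst u (twist ħ (-h) (-h) (conjS ψ))
    have h2 := inner_rightOp_rightOp ħ h (toL2 (twist ħ (-h) (-h) (conjS ψ))) (A (toL2 u))
    rw [rightOp_toL2, twist_neg_twist] at h2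
    rw [twist_neg_twist, ← h2, ← toDist_conjS, ← toDist_conjS, conjS_conjS] at h1
    rw [rightOp_toL2]
    exact h1

/-! ### Integrated right pulled action -/

theorem integrable_smul_rightOp (ħ : ℝ) (w : 𝓢(Phase n, ℂ)) (a : L2Phase n) :
    Integrable fun h => w h • rightOp ħ (-h) a := by
  have hc : Continuous fun h => w h • rightOp ħ (-h) a :=
    w.continuous.smul ((continuous_rightOp ħ a).comp continuous_neg)
  refine ((w.integrable (μ := volume)).norm.mul_const ‖a‖).mono' hc.aestronglyMeasurable
    (Filter.Eventually.of_forall fun h => ?_)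
  rw [norm_smul, norm_rightOp]

/-- The operator `∫ w(h) R(0,-h) dh` on `L²(ℝ²ⁿ)`. -/
def conv (ħ : ℝ) (w : 𝓢(Phase n, ℂ)) : L2Phase n →L[ℂ] L2Phase n :=
  LinearMap.mkContinuous
    { toFun := fun a => ∫ h, w h • rightOp ħ (-h) a
      map_add' := fun a b => by
        simp only [map_add, smul_add]
        exact integral_add (integrable_smul_rightOp ħ w a) (integrable_smul_rightOp ħ w b)
      map_smul' := fun c a => by
        simp only [map_smul, smul_comm _ c, RingHom.id_apply]
        exact integral_smul c _ }
    (∫ h, ‖w h‖) fun a => by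
      refine (norm_integral_le_integral_norm _).trans (le_of_eq ?_)
      simp only [norm_smul, norm_rightOp]
      exact integral_mul_const _ _

theorem conv_apply (ħ : ℝ) (w : 𝓢(Phase n, ℂ)) (a : L2Phase n) :
    conv ħ w a = ∫ h, w h • rightOp ħ (-h) a := rfl

theorem CommutesWithDerR.conv_apply {ħ : ℝ} {A : L2Phase n →L[ℂ] L2Phase n}
    (hA : CommutesWithDerR ħ A) (w : 𝓢(Phase n, ℂ)) (a : L2Phase n) :
    A (conv ħ w a) = conv ħ w (A a) := by
  rw [FockHeisenberg.conv_apply, FockHeisenberg.conv_apply,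
    ← A.integral_comp_comm (integrable_smul_rightOp ħ w a)]
  simp_rw [map_smul, hA.rightOp_apply]

theorem toDist_rightOp_neg_toL2 (ħ : ℝ) (h : Phase n) (u ψ : 𝓢(Phase n, ℂ)) :
    toDist (rightOp ħ (-h) (toL2 u)) ψ = ∫ q, phaseFactor ħ (symp n q) h * ψ (h + q) * u q := by
  rw [rightOp_toL2, toDist_toL2, ← integral_add_right_eq_self _ h]
  congr 1
  ext q
  simp only [twist_apply, phaseFactor, add_neg_cancel_right, map_neg, neg_apply, map_add, symp_self,
    symp_swap h q, add_comm h q]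
  simp only [neg_neg, neg_zero, add_zero]
  ring

theorem integrable_conv_kernel (ħ : ℝ) (w u ψ : 𝓢(Phase n, ℂ)) :
    Integrable (Function.uncurry fun h q : Phase n =>
      w h * (phaseFactor ħ (symp n q) h * ψ (h + q) * u q)) (volume.prod volume) := by
  have h1 : Integrable (fun z : Phase n × Phase n => w z.1 * u z.2) (volume.prod volume) :=
    (w.integrable (μ := volume)).mul_prod (u.integrable (μ := volume))
  have hc : Continuous fun z : Phase n × Phase n => phaseFactor ħ (symp n z.2) z.1 := by
    have : Continuous fun z : Phase n × Phase n => symp n z.2 z.1 :=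
      ((symp n).continuous.comp continuous_snd).clm_apply continuous_fst
    unfold phaseFactor
    fun_prop
  have h2 := h1.mul_bdd (c := SchwartzMap.seminorm ℝ 0 0 ψ)
    (g := fun z : Phase n × Phase n => phaseFactor ħ (symp n z.2) z.1 * ψ (z.1 + z.2))
    (by
      refine Continuous.aestronglyMeasurable ?_
      fun_prop)
    (Filter.Eventually.of_forall fun z => by
      rw [norm_mul, norm_phaseFactor, one_mul]
      exact norm_le_seminorm ℝ ψ _)
  refine h2.congr (Filter.Eventually.of_forall fun z => ?_)
  simp only [Function.uncurry]
  ring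

/-- Fubini after the substitution p = h + q: the right action of -h on a becomes the left action of
q on w. For Schwartz a this is a computation; both sides are continuous in a. -/
theorem toDist_conv (ħ : ℝ) (w : 𝓢(Phase n, ℂ)) (a : L2Phase n) (ψ : 𝓢(Phase n, ℂ)) :
    toDist (conv ħ w a) ψ = toDist a (coef ħ w ψ) := by
  induction a using DenseRange.induction_on denseRange_toL2 with
  | hp =>
    exact isClosed_eq ((toDistCLM ψ).continuous.comp (conv ħ w).continuous)
      (toDistCLM (coef ħ w ψ)).continuous
  | ih u =>
    rw [toDist_toL2, conv_apply, ← toDistCLM_apply,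
      ← (toDistCLM ψ).integral_comp_comm (integrable_smul_rightOp ħ w (toL2 u))]
    simp_rw [map_smul, toDistCLM_apply, toDist_rightOp_neg_toL2, smul_eq_mul, coef_apply,
      coefFun_eq_integral, ← integral_const_mul, ← integral_mul_const]
    rw [integral_integral_swap (integrable_conv_kernel ħ w u ψ)]
    congr 1
    ext q
    congr 1
    ext h
    ring

/-! ### A square integrable fundamental solution -/

section Flat

open FourierTransform Laplacian

/-- The operator `1 - (2π)⁻² Δ` on Schwartz functions on configuration space, as a sum of second
order directional derivatives. -/
def besselOp (n : ℕ) : 𝓢(Config n, ℂ) →L[ℂ] 𝓢(Config n, ℂ) :=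
  ContinuousLinearMap.id ℂ _ - ((2 * Real.pi : ℂ) ^ 2)⁻¹ • ∑ j : Fin n,
    lineDerivOpCLM ℂ 𝓢(Config n, ℂ) (EuclideanSpace.single j (1 : ℝ))
      ∘L lineDerivOpCLM ℂ 𝓢(Config n, ℂ) (EuclideanSpace.single j (1 : ℝ))

theorem fourier_besselOp (ψ : 𝓢(Config n, ℂ)) (ξ : Config n) :
    𝓕 (besselOp n ψ) ξ = ((1 + ‖ξ‖ ^ 2 : ℝ) : ℂ) * 𝓕 ψ ξ := by
  have h1 : besselOp n ψ = ψ - ((2 * Real.pi : ℂ) ^ 2)⁻¹ • Δ ψ := by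
    rw [laplacian_eq_sum (EuclideanSpace.basisFun (Fin n) ℝ) ψ]
    simp [besselOp]
  have h2 : 𝓕 (Δ ψ) ξ = -(2 * Real.pi : ℂ) ^ 2 * (‖ξ‖ ^ 2 * 𝓕 ψ ξ) := by
    rw [laplacian_eq_fourierMultiplierCLM, ← fourierMultiplierCLM_ofReal ℂ (by fun_prop),
      fourierMultiplierCLM_apply, ← Complex.coe_smul, FourierTransform.fourier_smul,
      FourierTransform.fourier_fourierInv_eq, smul_apply,
      smulLeftCLM_apply_apply (by fun_prop)]
    simp
  have h3 : 𝓕 (besselOp n ψ) = 𝓕 ψ - ((2 * Real.pi : ℂ) ^ 2)⁻¹ • 𝓕 (Δ ψ) := by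
    rw [h1, ← FourierTransform.fourier_smul]
    exact (fourierCLM ℂ 𝓢(Config n, ℂ)).map_sub _ _
  rw [h3, sub_apply, smul_apply, h2, smul_eq_mul]
  have : (2 * Real.pi : ℂ) ≠ 0 := by simp [Real.pi_ne_zero]
  field_simp
  push_cast
  ring

theorem fourier_besselOp_pow (N : ℕ) (ψ : 𝓢(Config n, ℂ)) (ξ : Config n) :
    𝓕 ((besselOp n ^ N) ψ) ξ = ((1 + ‖ξ‖ ^ 2 : ℝ) : ℂ) ^ N * 𝓕 ψ ξ := by
  induction N with
  | zero => simp
  | succ N ih =>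
    rw [pow_succ', mul_apply_eq_comp, fourier_besselOp, ih, pow_succ]
    ring

/-- The Fourier symbol of the N-th power is (1 + ‖ξ‖²)^N, whose inverse is square integrable for
large N. The solution is its Fourier transform: the symbol cancels, leaving ∫ 𝓕ψ = ψ(0). -/
theorem exists_fundamental_besselOp (n : ℕ) : ∃ (N : ℕ) (E : L2Config n),
    ∀ ψ : 𝓢(Config n, ℂ), ∫ x, (besselOp n ^ N) ψ x * E x = ψ 0 := by
  set N := n + 1
  have hpos : ∀ ξ : Config n, 0 < 1 + ‖ξ‖ ^ 2 := fun ξ => by positivity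
  have hm : MemLp (fun ξ : Config n => (((1 + ‖ξ‖ ^ 2 : ℝ) : ℂ) ^ N)⁻¹) 2 volume := by
    have hc : Continuous (fun ξ : Config n => (((1 + ‖ξ‖ ^ 2 : ℝ) : ℂ) ^ N)⁻¹) := by
      refine Continuous.inv₀ (by fun_prop) fun ξ => pow_ne_zero _ ?_
      exact_mod_cast (hpos ξ).ne'
    rw [memLp_two_iff_integrable_sq_norm hc.aestronglyMeasurable]
    -- The squared modulus is (1 + ‖ξ‖²)^(-2N), that is exponent -r/2 with r = 4N; integrability
    -- needs r > n.
    have hi := integrable_rpow_neg_one_add_norm_sq (E := Config n) (μ := volume)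
      (r := 4 * N) (by simp [N]; linarith [(Nat.cast_nonneg n : (0 : ℝ) ≤ n)])
    refine hi.congr (Filter.Eventually.of_forall fun ξ => ?_)
    simp only [norm_inv, norm_pow, Complex.norm_real, Real.norm_of_nonneg (hpos ξ).le]
    rw [show (-(4 * (N : ℝ)) / 2) = -((N * 2 : ℕ) : ℝ) by push_cast; ring,
      Real.rpow_neg (hpos ξ).le, Real.rpow_natCast, pow_mul, inv_pow]
  set M : L2Config n := hm.toLp
  refine ⟨N, 𝓕 M, fun ψ => ?_⟩
  have h1 : ∫ x, (besselOp n ^ N) ψ x * (𝓕 M : L2Config n) x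
      = ∫ ξ, 𝓕 ((besselOp n ^ N) ψ) ξ * M ξ := by
    have := congrArg (fun T => T ((besselOp n ^ N) ψ)) (Lp.fourier_toTemperedDistribution_eq M)
    simp only [TemperedDistribution.fourier_apply, Lp.toTemperedDistribution_apply] at this
    simpa using this.symm
  rw [h1]
  have h2 : ∫ ξ, 𝓕 ((besselOp n ^ N) ψ) ξ * M ξ = ∫ ξ, 𝓕 ψ ξ := by
    refine integral_congr_ae ?_
    filter_upwards [hm.coeFn_toLp] with ξ hξ
    rw [hξ, fourier_besselOp_pow]
    have : (((1 + ‖ξ‖ ^ 2 : ℝ) : ℂ) ^ N) ≠ 0 := pow_ne_zero _ (by exact_mod_cast (hpos ξ).ne')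
    field_simp
  rw [h2]
  have h3 : 𝓕⁻ (𝓕 ψ) 0 = ψ 0 := by rw [FourierTransform.fourierInv_fourier_eq]
  rw [← h3, fourierInv_coe, Real.fourierInv_eq]
  simp

end Flat

/-! ### Reduction of the twisted operators to the flat one. -/

/-- The operator `1 - (2π)⁻² ∑_j L_j²`, where `L_j` is the transposed derived right pulled action in
the direction `e j`. -/
def twistedBesselOp (ħ : ℝ) (e : Fin n → Phase n) : 𝓢(Phase n, ℂ) →L[ℂ] 𝓢(Phase n, ℂ) :=
  ContinuousLinearMap.id ℂ _ - ((2 * Real.pi : ℂ) ^ 2)⁻¹ • ∑ j : Fin n, derL ħ (e j) ∘L derL ħ (e j)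

/-- Restriction of a Schwartz function to `{x} × ℝⁿ`, multiplied by `y ↦ exp(π i ħ x y)`. -/
def restrictSnd (ħ : ℝ) (x : Config n) : 𝓢(Phase n, ℂ) →L[ℂ] 𝓢(Config n, ℂ) :=
  smulLeftCLM ℂ (phaseFactor ħ (innerSL ℝ x)) ∘L compCLMOfAntilipschitz (K := 1) ℂ
    (g := fun y : Config n => (x, y))
    (by
      have h : (fun y : Config n => (x, y)) = fun y => (x, (0 : Config n))
          + ContinuousLinearMap.inr ℝ (Config n) (Config n) y := by
        ext y <;> simp
      rw [h]
      fun_prop)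
    (AntilipschitzWith.of_le_mul_dist fun y y' => by simp [Prod.dist_eq])

/-- Restriction of a Schwartz function to `ℝⁿ × {0}`. -/
def restrictFst (n : ℕ) : 𝓢(Phase n, ℂ) →L[ℂ] 𝓢(Config n, ℂ) :=
  compCLMOfAntilipschitz (K := 1) ℂ (g := ContinuousLinearMap.inl ℝ (Config n) (Config n))
    (ContinuousLinearMap.hasTemperateGrowth _)
    (AntilipschitzWith.of_le_mul_dist fun y y' => by simp [Prod.dist_eq])

theorem restrictSnd_apply (ħ : ℝ) (x y : Config n) (χ : 𝓢(Phase n, ℂ)) :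
    restrictSnd ħ x χ y = phaseFactor ħ (innerSL ℝ x) y * χ (x, y) := by
  simp [restrictSnd, smulLeftCLM_apply_apply (phaseFactor_hasTemperateGrowth ħ (innerSL ℝ x))]

theorem restrictFst_apply (x : Config n) (χ : 𝓢(Phase n, ℂ)) : restrictFst n χ x = χ (x, 0) := by
  simp [restrictFst]

/-- For fixed x the multiplication term of the generator is the constant -πiħ x·e, which the factor
exp(πiħ x·y) gauges away. -/
theorem restrictSnd_derL (ħ : ℝ) (x e : Config n) (χ : 𝓢(Phase n, ℂ)) :
    restrictSnd ħ x (derL ħ (0, e) χ) = -∂_{e} (restrictSnd ħ x χ) := by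
  ext y
  have h1 : HasFDerivAt (fun y : Config n => χ (x, y))
      (fderiv ℝ χ (x, y) ∘L ContinuousLinearMap.inr ℝ (Config n) (Config n)) y :=
    (χ.hasFDerivAt (x, y)).comp y (hasFDerivAt_prodMk_right x y)
  have h2 := (hasFDerivAt_phaseFactor ħ (innerSL ℝ x) y).mul h1
  have h3 : (restrictSnd ħ x χ : Config n → ℂ)
      = phaseFactor ħ (innerSL ℝ x) * fun y => χ (x, y) :=
    funext fun y => restrictSnd_apply ħ x y χ
  rw [neg_apply, lineDerivOp_apply_eq_fderiv, h3, h2.fderiv, restrictSnd_apply, derL_apply,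
    symp_apply]
  simp [real_inner_comm x e]
  ring

/-- On y = 0 the form (e,0) ∧ (x,0) vanishes, so no gauge factor is needed. -/
theorem restrictFst_derL (ħ : ℝ) (e : Config n) (χ : 𝓢(Phase n, ℂ)) :
    restrictFst n (derL ħ (e, 0) χ) = -∂_{e} (restrictFst n χ) := by
  ext x
  have h1 : HasFDerivAt (fun x : Config n => χ (x, 0))
      (fderiv ℝ χ (x, 0) ∘L ContinuousLinearMap.inl ℝ (Config n) (Config n)) x :=
    (χ.hasFDerivAt (x, 0)).comp x (hasFDerivAt_prodMk_left x 0)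
  have h3 : (restrictFst n χ : Config n → ℂ) = fun x => χ (x, 0) :=
    funext fun x => restrictFst_apply x χ
  rw [neg_apply, lineDerivOp_apply_eq_fderiv, h3, h1.fderiv, restrictFst_apply, derL_apply,
    symp_apply]
  simp

theorem besselOp_pow_comp_of_derL {ħ : ℝ} {e : Fin n → Phase n}
    (J : 𝓢(Phase n, ℂ) →L[ℂ] 𝓢(Config n, ℂ))
    (hJ : ∀ j χ, J (derL ħ (e j) χ) = -∂_{(EuclideanSpace.single j (1 : ℝ) : Config n)} (J χ))
    (N : ℕ) (χ : 𝓢(Phase n, ℂ)) :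
    J ((twistedBesselOp ħ e ^ N) χ) = (besselOp n ^ N) (J χ) := by
  induction N generalizing χ with
  | zero => simp
  | succ N ih =>
    rw [pow_succ, pow_succ, mul_apply_eq_comp, mul_apply_eq_comp, ih]
    congr 1
    simp only [twistedBesselOp, besselOp, sub_apply, smul_apply, map_sub, map_smul,
      ContinuousLinearMap.id_apply, _root_.sum_apply, ContinuousLinearMap.comp_apply, map_sum, hJ,
      lineDerivOpCLM_apply]
    simp

/-- The transpose of an invariant differential operator which has a square integrable fundamental
solution. -/
def fundOp (ħ : ℝ) (n N : ℕ) : 𝓢(Phase n, ℂ) →L[ℂ] 𝓢(Phase n, ℂ) :=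
  twistedBesselOp ħ (fun j : Fin n => ((0, EuclideanSpace.single j (1 : ℝ)) : Phase n)) ^ N
    * twistedBesselOp ħ (fun j : Fin n => ((EuclideanSpace.single j (1 : ℝ), 0) : Phase n)) ^ N

/-- The solution is exp(πiħ x·y) E(x)E(y) with E the flat solution. Integration over y removes the
Y-operator and sets y = 0; there the X-operator is flat, and integration over x finishes. This is
why the Y-factor is the outer one in `fundOp`. -/
theorem exists_fundamental_fundOp (ħ : ℝ) (n : ℕ) : ∃ (N : ℕ) (γ : L2Phase n),
    ∀ ψ, toDist γ (fundOp ħ n N ψ) = ψ 0 := by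
  obtain ⟨N, E, hE⟩ := exists_fundamental_besselOp n
  set G : Phase n → ℂ := fun p => phaseFactor ħ (innerSL ℝ p.1) p.2 * (E p.1 * E p.2)
  have hphase : Continuous fun p : Phase n => phaseFactor ħ (innerSL ℝ p.1) p.2 := by
    have : Continuous fun p : Phase n => inner ℝ p.1 p.2 := by fun_prop
    unfold phaseFactor
    simp only [innerSL_apply_apply]
    fun_prop
  have hG : MemLp G 2 volume := by
    have hmeas : AEStronglyMeasurable G volume :=
      hphase.aestronglyMeasurable.mul
        ((Lp.aestronglyMeasurable E).comp_fst.mul (Lp.aestronglyMeasurable E).comp_snd)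
    rw [memLp_two_iff_integrable_sq_norm hmeas]
    have hE2 := (memLp_two_iff_integrable_sq_norm (Lp.aestronglyMeasurable E)).1 (Lp.memLp E)
    refine (hE2.mul_prod hE2).congr (Filter.Eventually.of_forall fun p => ?_)
    simp [G, mul_pow]
  refine ⟨N, hG.toLp, fun ψ => ?_⟩
  set χ := (twistedBesselOp ħ
    (fun j : Fin n => ((EuclideanSpace.single j (1 : ℝ), 0) : Phase n)) ^ N) ψ with hχ
  set η := (twistedBesselOp ħ
    (fun j : Fin n => ((0, EuclideanSpace.single j (1 : ℝ)) : Phase n)) ^ N) χ with hη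
  have h1 : toDist (hG.toLp : L2Phase n) (fundOp ħ n N ψ) = ∫ p : Phase n, η p * G p := by
    rw [toDist_apply]
    refine integral_congr_ae ?_
    filter_upwards [hG.coeFn_toLp] with p hp
    rw [hp]
    rfl
  have hint : Integrable (fun p : Phase n => η p * G p) (volume.prod volume) :=
    (η.memLp 2 (volume : Measure (Phase n))).integrable_mul hG
  rw [h1, Measure.volume_eq_prod, integral_prod _ hint]
  have h2 : ∀ x : Config n, ∫ y, η (x, y) * G (x, y) = restrictFst n χ x * E x := by
    intro x
    have h3 : ∀ y, η (x, y) * G (x, y)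
        = E x * ((besselOp n ^ N) (restrictSnd ħ x χ) y * E y) := by
      intro y
      rw [← besselOp_pow_comp_of_derL (ħ := ħ)
        (e := fun j : Fin n => ((0, EuclideanSpace.single j (1 : ℝ)) : Phase n))
        (restrictSnd ħ x) (fun j χ => restrictSnd_derL ħ x _ χ), restrictSnd_apply]
      simp only [G, ← hη]
      ring
    simp_rw [h3]
    rw [integral_const_mul, hE, restrictSnd_apply, restrictFst_apply]
    simp [phaseFactor, mul_comm]
  simp_rw [h2, hχ]
  rw [besselOp_pow_comp_of_derL (ħ := ħ)
        (e := fun j : Fin n => ((EuclideanSpace.single j (1 : ℝ), 0) : Phase n))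
        (restrictFst n) (fun j χ => restrictFst_derL ħ _ χ), hE, restrictFst_apply]
  rfl

/-- Only squares of generators occur, so the signs in `derL_coef` cancel. -/
theorem twistedBesselOp_coef (ħ : ℝ) (e : Fin n → Phase n) (w ψ : 𝓢(Phase n, ℂ)) :
    twistedBesselOp ħ e (coef ħ w ψ) = coef ħ (twistedBesselOp ħ e w) ψ := by
  let l : 𝓢(Phase n, ℂ) →ₗ[ℂ] 𝓢(Phase n, ℂ) :=
    { toFun := fun w => coef ħ w ψ
      map_add' := fun w w' => coef_add_left ħ w w' ψ
      map_smul' := fun c w => coef_smul_left ħ c w ψ }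
  have hl : ∀ w, coef ħ w ψ = l w := fun w => rfl
  have h2 : ∀ j, derL ħ (e j) (derL ħ (e j) (l w)) = l (derL ħ (e j) (derL ħ (e j) w)) := by
    intro j
    rw [← hl, ← hl, derL_coef, map_neg, derL_coef, neg_neg]
  rw [hl, hl]
  simp only [twistedBesselOp, sub_apply, smul_apply, _root_.sum_apply,
    ContinuousLinearMap.id_apply, ContinuousLinearMap.comp_apply, map_sub, map_smul, map_sum, h2]

theorem twistedBesselOp_pow_coef (ħ : ℝ) (e : Fin n → Phase n) (N : ℕ) (w ψ : 𝓢(Phase n, ℂ)) :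
    (twistedBesselOp ħ e ^ N) (coef ħ w ψ) = coef ħ ((twistedBesselOp ħ e ^ N) w) ψ := by
  induction N generalizing w with
  | zero => simp
  | succ N ih =>
    rw [pow_succ, mul_apply_eq_comp, mul_apply_eq_comp,
      twistedBesselOp_coef, ih]

theorem fundOp_coef (ħ : ℝ) (N : ℕ) (w ψ : 𝓢(Phase n, ℂ)) :
    fundOp ħ n N (coef ħ w ψ) = coef ħ (fundOp ħ n N w) ψ := by
  rw [fundOp, mul_apply_eq_comp, mul_apply_eq_comp,
    twistedBesselOp_pow_coef, twistedBesselOp_pow_coef]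

/-! ### The kernel of an operator commuting with the right pulled action -/

theorem leftCoefficient_eq_coef (ħ : ℝ) (u v : 𝓢(Phase n, ℂ)) :
    (coef ħ u (conjS v) : Phase n → ℂ) = leftCoefficient ħ u v := by
  ext g
  rw [coef_apply, coefFun, leftCoefficient]
  congr 1
  ext p
  rw [twist_apply, conjS_apply, leftAction, phaseFactor, symp_apply, sub_eq_add_neg p g]
  congr 3
  push_cast
  ring

theorem CommutesWithDerR.isLeftRelativeConvolution {ħ : ℝ} {A : L2Phase n →L[ℂ] L2Phase n}
    (hA : CommutesWithDerR ħ A) : IsLeftRelativeConvolution ħ A := by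
  obtain ⟨N, γ, hγ⟩ := exists_fundamental_fundOp ħ n
  -- The kernel is A applied to the fundamental solution, followed by the transpose of `fundOp`; it
  -- stands for A applied to δ.
  refine ⟨PointwiseConvergenceCLM.precomp ℂ (fundOp ħ n N) (toDist (A γ)), fun u v =>
    ⟨coef ħ u (conjS v), leftCoefficient_eq_coef ħ u v, ?_⟩⟩
  -- Tested on ψ, the left side is the coefficient of u and ψ at g = 0, which is ∫ u ψ.
  have h1 : conv ħ (fundOp ħ n N u) γ = toL2 u := by
    refine toDist_ext fun ψ => ?_
    rw [toDist_conv, ← fundOp_coef, hγ, coef_apply, coefFun, toDist_toL2]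
    congr 1
    ext p
    simp [mul_comm]
  have h2 : toDist (A γ) (fundOp ħ n N (coef ħ u (conjS v)))
      = toDist (A (conv ħ (fundOp ħ n N u) γ)) (conjS v) := by
    rw [fundOp_coef, ← toDist_conv, hA.conv_apply]
  refine h2.trans ?_
  rw [h1, toDist_conjS, ← toLp_eq_toL2, ← toLp_eq_toL2]

/-! ### Gaussians are Schwartz functions -/

theorem one_add_pow_mul_exp_neg_le (k : ℕ) {c : ℝ} (hc : 0 < c) :
    ∃ C, ∀ r : ℝ, 0 ≤ r → (1 + r) ^ k * Real.exp (-(c * r ^ 2)) ≤ C := by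
  -- Uses 1 + r ≤ 2(1 + r²) and x^k / k! ≤ exp x at x = c(1 + r²); the surplus factor is exp c.
  refine ⟨2 ^ k * (Real.exp c * (k.factorial / c ^ k)), fun r hr => ?_⟩
  have h1 : (1 + r) ^ k ≤ 2 ^ k * (1 + r ^ 2) ^ k := by
    rw [← mul_pow]
    gcongr
    nlinarith [sq_nonneg (r - 1)]
  have h2 := Real.pow_div_factorial_le_exp (c * (1 + r ^ 2)) (by positivity) k
  rw [mul_pow, div_le_iff₀ (by positivity)] at h2
  have h3 : (1 + r ^ 2) ^ k ≤ k.factorial / c ^ k * Real.exp (c * (1 + r ^ 2)) := by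
    rw [div_mul_eq_mul_div, le_div_iff₀ (by positivity)]
    linarith
  calc (1 + r) ^ k * Real.exp (-(c * r ^ 2))
      ≤ 2 ^ k * (k.factorial / c ^ k * Real.exp (c * (1 + r ^ 2))) * Real.exp (-(c * r ^ 2)) := by
        gcongr
        exact h1.trans (by gcongr)
    _ = 2 ^ k * (k.factorial / c ^ k) * (Real.exp (c * (1 + r ^ 2)) * Real.exp (-(c * r ^ 2))) := by
        ring
    _ = 2 ^ k * (Real.exp c * (k.factorial / c ^ k)) := by
        rw [← Real.exp_add]
        ring_nf

theorem hasTemperateGrowth_fderiv_apply {E : Type*} [NormedAddCommGroup E] [NormedSpace ℝ E]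
    {f : E → ℂ} (hf : f.HasTemperateGrowth) (e : E) :
    (fun x => fderiv ℝ f x e).HasTemperateGrowth := by
  have h1 : (fderiv ℝ f).HasTemperateGrowth := by
    refine ⟨hf.1.fderiv_right (by simp), fun k => ?_⟩
    obtain ⟨l, C, hC⟩ := hf.2 (k + 1)
    exact ⟨l, C, fun x => by rw [norm_iteratedFDeriv_fderiv]; exact hC x⟩
  exact (ContinuousLinearMap.apply ℝ ℂ e).hasTemperateGrowth.comp h1

theorem exists_schwartzMap_exp_neg {E : Type*} [NormedAddCommGroup E] [NormedSpace ℝ E]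
    [FiniteDimensional ℝ E] {q : E → ℝ} (hq : q.HasTemperateGrowth) {c : ℝ} (hc : 0 < c)
    (hqc : ∀ x, c * ‖x‖ ^ 2 ≤ q x) :
    ∃ s : 𝓢(E, ℂ), ∀ x, s x = Complex.exp ((-q x : ℝ) : ℂ) := by
  set G : E → ℂ := fun x => Complex.exp ((-q x : ℝ) : ℂ) with hG
  have hqd : ∀ x, HasFDerivAt q (fderiv ℝ q x) x :=
    fun x => ((hq.1.differentiable (by simp)) x).hasFDerivAt
  have hGd : ∀ x, HasFDerivAt G (G x • (Complex.ofRealCLM ∘L (-fderiv ℝ q x))) x := by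
    intro x
    have h1 : HasFDerivAt (fun x => ((-q x : ℝ) : ℂ)) (Complex.ofRealCLM ∘L (-fderiv ℝ q x)) x :=
      Complex.ofRealCLM.hasFDerivAt.comp x (hqd x).neg
    exact h1.cexp
  have hqC : (fun x => (q x : ℂ)).HasTemperateGrowth :=
    Complex.ofRealCLM.hasTemperateGrowth.comp hq
  have hqe : ∀ x e, fderiv ℝ (fun x => (q x : ℂ)) x e = (fderiv ℝ q x e : ℂ) := by
    intro x e
    have : HasFDerivAt (fun x => (q x : ℂ)) (Complex.ofRealCLM ∘L (fderiv ℝ q x)) x :=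
      Complex.ofRealCLM.hasFDerivAt.comp x (hqd x)
    rw [this.fderiv]
    rfl
  -- Products of exp(-q) with functions of temperate growth are closed under derivatives and linear
  -- forms, and the Gaussian bound makes each of them bounded.
  set V : Set (E → ℂ) := {g | ∃ f : E → ℂ, f.HasTemperateGrowth ∧ g = fun x => f x * G x}
  have hfG : ∀ f : E → ℂ, f.HasTemperateGrowth → ∀ x, HasFDerivAt (fun x => f x * G x)
      (f x • (G x • (Complex.ofRealCLM ∘L (-fderiv ℝ q x))) + G x • fderiv ℝ f x) x := by
    intro f hf x
    exact ((hf.1.differentiable (by simp)) x).hasFDerivAt.mul (hGd x)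
  suffices h : ∃ s : 𝓢(E, ℂ), (s : E → ℂ) = G from h.imp fun s hs x => congrFun hs x
  refine exists_schwartzMap_of_family V ?_ ?_ ?_ ?_ ⟨fun _ => 1, .const 1, by simp⟩
  · rintro _ ⟨f, hf, rfl⟩
    obtain ⟨k, C, hC⟩ := hf.2 0
    obtain ⟨C', hC'⟩ := one_add_pow_mul_exp_neg_le k hc
    refine ⟨|C| * C', fun x => ?_⟩
    have h1 : ‖f x‖ ≤ C * (1 + ‖x‖) ^ k := by simpa using hC x
    have h2 : ‖G x‖ ≤ Real.exp (-(c * ‖x‖ ^ 2)) := by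
      rw [hG, Complex.norm_exp_ofReal]
      gcongr
      exact hqc x
    calc ‖f x * G x‖ = ‖f x‖ * ‖G x‖ := norm_mul _ _
      _ ≤ (|C| * (1 + ‖x‖) ^ k) * Real.exp (-(c * ‖x‖ ^ 2)) := by
        gcongr
        exact h1.trans (by gcongr; exact le_abs_self C)
      _ = |C| * ((1 + ‖x‖) ^ k * Real.exp (-(c * ‖x‖ ^ 2))) := by ring
      _ ≤ |C| * C' := by
        gcongr
        exact hC' _ (norm_nonneg x)
  · rintro _ ⟨f, hf, rfl⟩
    exact fun x => (hfG f hf x).differentiableAt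
  · rintro _ ⟨f, hf, rfl⟩ e
    refine ⟨fun x => fderiv ℝ f x e - f x * fderiv ℝ (fun x => (q x : ℂ)) x e,
      (hasTemperateGrowth_fderiv_apply hf e).fun_sub
        (hf.mul (hasTemperateGrowth_fderiv_apply hqC e)), ?_⟩
    funext x
    simp only [(hfG f hf x).fderiv, hqe]
    simp
    ring
  · rintro _ ⟨f, hf, rfl⟩ ℓ
    refine ⟨fun x => (ℓ x : ℂ) * f x, (ofReal_clm_hasTemperateGrowth ℓ).mul hf, ?_⟩
    funext x
    ring

theorem exists_gaussianS (n : ℕ) {ħ τ : ℝ} (hħ : 0 < ħ) (hτ : 0 < τ) :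
    ∃ s : 𝓢(Config n, ℂ), (s : Config n → ℂ) = gaussian ħ τ := by
  obtain ⟨s, hs⟩ := exists_schwartzMap_exp_neg (E := Config n)
    (q := fun t => Real.pi * ħ / τ * ‖t‖ ^ 2) (by fun_prop) (c := Real.pi * ħ / τ) (by positivity)
    (fun x => le_rfl)
  refine ⟨s, funext fun t => ?_⟩
  rw [hs, gaussian]
  congr 3
  ring

/-- The function `⟨φ, ρ(0,x,y) φ⟩` for the squeezed Gaussian `φ`. -/
theorem covariantTransform_gaussian {ħ τ : ℝ} (hħ : 0 < ħ) (hτ : 0 < τ) (g : Phase n) :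
    covariantTransform ħ (gaussian ħ τ) (gaussian ħ τ) g
      = ((Real.pi : ℂ) / ((2 * Real.pi * ħ / τ : ℝ) : ℂ)) ^ (n / 2 : ℂ) *
        Complex.exp ((-(Real.pi * ħ / (2 * τ) * ‖g.1‖ ^ 2 + Real.pi * ħ * τ / 2 * ‖g.2‖ ^ 2) : ℝ) : ℂ)
      := by
  -- Shifting t by x/2 makes the product of the two Gaussians even in t, by the parallelogram law,
  -- and cancels the x·y phase.
  rw [covariantTransform, ← integral_add_right_eq_self _ ((1 / 2 : ℝ) • g.1)]
  have h1 : ∀ t : Config n, gaussian ħ τ (t + (1 / 2 : ℝ) • g.1) *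
      conj (schrodinger ħ 0 g (gaussian ħ τ) (t + (1 / 2 : ℝ) • g.1))
      = Complex.exp ((-(Real.pi * ħ / (2 * τ) * ‖g.1‖ ^ 2) : ℝ) : ℂ) *
        Complex.exp (-((2 * Real.pi * ħ / τ : ℝ) : ℂ) * ‖t‖ ^ 2
          + (2 * Real.pi * ħ * Complex.I) * (inner ℝ g.2 t : ℝ)) := by
    intro t
    have e1 : t + (1 / 2 : ℝ) • g.1 - g.1 = t - (1 / 2 : ℝ) • g.1 := by
      module
    have e2 : ‖t + (1 / 2 : ℝ) • g.1‖ ^ 2 + ‖t - (1 / 2 : ℝ) • g.1‖ ^ 2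
        = 2 * ‖t‖ ^ 2 + ‖g.1‖ ^ 2 / 2 := by
      rw [norm_add_sq_real, norm_sub_sq_real, norm_smul]
      norm_num
      ring
    have e3 : -(Real.pi * ħ * ‖t + (1 / 2 : ℝ) • g.1‖ ^ 2 / τ)
        + -(Real.pi * ħ * ‖t - (1 / 2 : ℝ) • g.1‖ ^ 2 / τ)
        = -(Real.pi * ħ / (2 * τ) * ‖g.1‖ ^ 2) + -(2 * Real.pi * ħ / τ * ‖t‖ ^ 2) := by
      have : -(Real.pi * ħ * ‖t + (1 / 2 : ℝ) • g.1‖ ^ 2 / τ)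
        + -(Real.pi * ħ * ‖t - (1 / 2 : ℝ) • g.1‖ ^ 2 / τ) = -(Real.pi * ħ / τ) *
          (‖t + (1 / 2 : ℝ) • g.1‖ ^ 2 + ‖t - (1 / 2 : ℝ) • g.1‖ ^ 2) := by ring
      rw [this, e2]
      field_simp
      ring
    have e3c := congrArg (fun r : ℝ => (r : ℂ)) e3
    rw [schrodinger, gaussian, gaussian, e1, map_mul, ← Complex.exp_conj, ← Complex.exp_conj,
      ← Complex.exp_add, ← Complex.exp_add, ← Complex.exp_add]
    congr 1
    simp only [map_mul, Complex.conj_ofReal, Complex.conj_I, inner_add_right, inner_smul_right,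
      real_inner_comm g.2 g.1]
    push_cast at e3c ⊢
    linear_combination e3c
  simp_rw [h1]
  rw [integral_const_mul, GaussianFourier.integral_cexp_neg_mul_sq_norm_add
    (by simp only [Complex.ofReal_re]; positivity), mul_left_comm, ← Complex.exp_add]
  congr 2
  · simp
  · push_cast
    have : (Real.pi : ℂ) ≠ 0 := by simp [Real.pi_ne_zero]
    have : (ħ : ℂ) ≠ 0 := by simp [hħ.ne']
    have : (τ : ℂ) ≠ 0 := by simp [hτ.ne']
    field_simp
    rw [Complex.I_sq]
    ring

theorem exists_vacuumS (n : ℕ) {ħ τ : ℝ} (hħ : 0 < ħ) (hτ : 0 < τ) :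
    ∃ s : 𝓢(Phase n, ℂ), (s : Phase n → ℂ)
      = covariantTransform ħ (gaussian ħ τ) (gaussian ħ τ) := by
  have hq : (fun p : Phase n => Real.pi * ħ / (2 * τ) * ‖p.1‖ ^ 2
      + Real.pi * ħ * τ / 2 * ‖p.2‖ ^ 2).HasTemperateGrowth := by
    have h1 : (fun p : Phase n => ‖p.1‖ ^ 2).HasTemperateGrowth :=
      (Function.hasTemperateGrowth_norm_sq (H := Config n)).comp
        (ContinuousLinearMap.fst ℝ (Config n) (Config n)).hasTemperateGrowth
    have h2 : (fun p : Phase n => ‖p.2‖ ^ 2).HasTemperateGrowth :=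
      (Function.hasTemperateGrowth_norm_sq (H := Config n)).comp
        (ContinuousLinearMap.snd ℝ (Config n) (Config n)).hasTemperateGrowth
    fun_prop
  obtain ⟨s, hs⟩ := exists_schwartzMap_exp_neg hq
    (c := min (Real.pi * ħ / (2 * τ)) (Real.pi * ħ * τ / 2)) (by positivity) (fun p => by
      set c := min (Real.pi * ħ / (2 * τ)) (Real.pi * ħ * τ / 2)
      have hc : 0 ≤ c := by positivity
      have h1 : c * ‖p.1‖ ^ 2 ≤ Real.pi * ħ / (2 * τ) * ‖p.1‖ ^ 2 := by
        gcongr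
        exact min_le_left _ _
      have h2 : c * ‖p.2‖ ^ 2 ≤ Real.pi * ħ * τ / 2 * ‖p.2‖ ^ 2 := by
        gcongr
        exact min_le_right _ _
      -- The norm on the product is the maximum norm, so one of the two squares already dominates.
      rcases max_choice ‖p.1‖ ‖p.2‖ with h | h
      · rw [Prod.norm_def, h]
        have : 0 ≤ c * ‖p.2‖ ^ 2 := by positivity
        linarith
      · rw [Prod.norm_def, h]
        have : 0 ≤ c * ‖p.1‖ ^ 2 := by positivity
        linarith)
  refine ⟨((Real.pi : ℂ) / ((2 * Real.pi * ħ / τ : ℝ) : ℂ)) ^ (n / 2 : ℂ) • s, funext fun g => ?_⟩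
  rw [covariantTransform_gaussian hħ hτ, smul_apply, hs, smul_eq_mul]

/-! ### The covariant transform as a bounded operator -/

/-- The inclusion of the Schwartz space into `L²(ℝⁿ)`. -/
def configToL2 : 𝓢(Config n, ℂ) →L[ℂ] L2Config n := toLpCLM ℂ ℂ 2 (volume : Measure (Config n))

theorem coeFn_configToL2 (f : 𝓢(Config n, ℂ)) : configToL2 f =ᵐ[volume] f :=
  f.coeFn_toLp 2 (volume : Measure (Config n))

theorem denseRange_configToL2 : DenseRange (configToL2 : 𝓢(Config n, ℂ) → L2Config n) :=
  denseRange_toLpCLM (F := ℂ) (p := 2) (μ := (volume : Measure (Config n))) ENNReal.ofNat_ne_top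

theorem norm_sq_configToL2 (f : 𝓢(Config n, ℂ)) : ‖configToL2 f‖ ^ 2 = ∫ x, ‖f x‖ ^ 2 := by
  have h1 : inner ℂ (configToL2 f) (configToL2 f) = ((∫ x, ‖f x‖ ^ 2 : ℝ) : ℂ) := by
    rw [L2.inner_def, ← integral_complex_ofReal]
    refine integral_congr_ae ?_
    filter_upwards [coeFn_configToL2 f] with x hx
    rw [hx, inner_self_eq_norm_sq_to_K]
    simp
  rw [@norm_sq_eq_re_inner ℂ, h1]
  rfl

attribute [irreducible] configToL2

theorem covariantTransform_congr_ae (ħ : ℝ) (θ : Config n → ℂ) {f f' : Config n → ℂ}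
    (h : f =ᵐ[volume] f') : covariantTransform ħ θ f = covariantTransform ħ θ f' := by
  funext g
  refine integral_congr_ae ?_
  filter_upwards [h] with t ht
  rw [ht]

/-- The Schrödinger representation on Schwartz functions. -/
def schrodingerS (ħ : ℝ) (g : Phase n) (θ : 𝓢(Config n, ℂ)) : 𝓢(Config n, ℂ) :=
  phaseFactor ħ (innerSL ℝ g.1) g.2 •
    smulLeftCLM ℂ (phaseFactor ħ (innerSL ℝ ((-2 : ℝ) • g.2))) (compSubConstCLM ℂ g.1 θ)

theorem schrodingerS_apply (ħ : ℝ) (g : Phase n) (θ : 𝓢(Config n, ℂ)) (t : Config n) :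
    schrodingerS ħ g θ t = schrodinger ħ 0 g θ t := by
  rw [schrodingerS, smul_apply, smulLeftCLM_apply_apply (phaseFactor_hasTemperateGrowth _ _),
    schrodinger, phaseFactor, phaseFactor, compSubConstCLM_apply, smul_eq_mul, smul_eq_mul,
    ← mul_assoc, ← Complex.exp_add]
  congr 2
  simp only [innerSL_apply_apply, inner_smul_left]
  push_cast
  simp
  ring

theorem covariantTransform_eq_inner (ħ : ℝ) (θ : 𝓢(Config n, ℂ)) (f : L2Config n) (g : Phase n) :
    covariantTransform ħ θ f g = inner ℂ (configToL2 (schrodingerS ħ g θ)) f := by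
  rw [covariantTransform, L2.inner_def]
  refine integral_congr_ae ?_
  filter_upwards [coeFn_configToL2 (schrodingerS ħ g θ)] with t ht
  rw [ht, schrodingerS_apply]
  rfl

/-- The Schrödinger and the left pulled action are intertwined by the covariant transform. -/
theorem covariantTransform_schrodingerS (ħ : ℝ) (θ f : 𝓢(Config n, ℂ)) (g p : Phase n) :
    covariantTransform ħ θ (schrodingerS ħ g f) p
      = phaseFactor ħ (symp n g) p * covariantTransform ħ θ f (p - g) := by
  rw [covariantTransform, covariantTransform, ← integral_const_mul,
    ← integral_sub_right_eq_self (fun t => phaseFactor ħ (symp n g) p *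
      (f t * conj (schrodinger ħ 0 (p - g) θ t))) g.1]
  congr 1
  ext t
  have e1 : t - g.1 - (p - g).1 = t - p.1 := by
    simp
  rw [schrodingerS_apply, schrodinger, schrodinger, schrodinger, e1, map_mul, map_mul, phaseFactor,
    ← Complex.exp_conj, ← Complex.exp_conj, symp_apply]
  have e2 : ∀ a b u v : ℂ, Complex.exp a * u * (Complex.exp b * v)
      = Complex.exp (a + b) * (u * v) := by
    intro a b u v
    rw [Complex.exp_add]
    ring
  have e3 : ∀ a b u v : ℂ, Complex.exp a * (u * (Complex.exp b * v))
      = Complex.exp (a + b) * (u * v) := by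
    intro a b u v
    rw [Complex.exp_add]
    ring
  rw [e2, e3]
  congr 2
  simp only [map_mul, Complex.conj_ofReal, Complex.conj_I, Prod.fst_sub, Prod.snd_sub,
    inner_sub_left, inner_sub_right, real_inner_comm g.2 p.1, real_inner_comm p.2 g.1,
    real_inner_comm g.2 g.1, real_inner_comm p.2 p.1]
  push_cast
  ring

section Plancherel

open FourierTransform

/-- The product of `f` with a translate of `conj θ`. -/
def translateMul (θ : 𝓢(Config n, ℂ)) (f : 𝓢(Config n, ℂ)) (x : Config n) : 𝓢(Config n, ℂ) :=
  smulLeftCLM ℂ (conjS (compSubConstCLM ℂ x θ)) f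

theorem translateMul_apply (θ f : 𝓢(Config n, ℂ)) (x t : Config n) :
    translateMul θ f x t = conj (θ (t - x)) * f t := by
  rw [translateMul, smulLeftCLM_apply_apply (SchwartzMap.hasTemperateGrowth _)]
  simp

/-- For fixed x the transform is a Fourier integral in y at frequency ħy, which opens the way to
Plancherel. -/
theorem covariantTransform_eq_fourierInv (ħ : ℝ) (θ f : 𝓢(Config n, ℂ)) (x y : Config n) :
    covariantTransform ħ θ f (x, y)
      = phaseFactor ħ (innerSL ℝ (-x)) y * 𝓕⁻ (translateMul θ f x) (ħ • y) := by
  rw [fourierInv_coe, Real.fourierInv_eq', covariantTransform, ← integral_const_mul]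
  congr 1
  ext t
  have e3 : ∀ a b c u v : ℂ, c = a + b → u * (Complex.exp c * v)
      = Complex.exp a * (Complex.exp b * (v * u)) := by
    rintro a b c u v rfl
    rw [Complex.exp_add]
    ring
  rw [translateMul_apply, schrodinger, phaseFactor, map_mul, ← Complex.exp_conj, smul_eq_mul]
  refine e3 _ _ _ _ _ ?_
  simp only [map_mul, Complex.conj_ofReal, Complex.conj_I, innerSL_apply_apply, inner_neg_left,
    inner_smul_right, real_inner_comm y t]
  push_cast
  ring

theorem integral_norm_sq_fourierInv (F : 𝓢(Config n, ℂ)) :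
    ∫ y, ‖𝓕⁻ F y‖ ^ 2 = ∫ t, ‖F t‖ ^ 2 := by
  rw [← integral_norm_sq_fourier (𝓕⁻ F), FourierTransform.fourier_fourierInv_eq]

theorem integrable_norm_sq {E : Type*} [NormedAddCommGroup E] [NormedSpace ℝ E]
    [FiniteDimensional ℝ E] [MeasurableSpace E] [BorelSpace E] (μ : Measure E)
    [μ.IsAddHaarMeasure] (F : 𝓢(E, ℂ)) : Integrable (fun t => ‖F t‖ ^ 2) μ :=
  (memLp_two_iff_integrable_sq_norm F.continuous.aestronglyMeasurable).1 (F.memLp 2 μ)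

theorem integral_norm_sq_covariantTransform_snd {ħ : ℝ} (hħ : 0 < ħ) (θ f : 𝓢(Config n, ℂ))
    (x : Config n) :
    Integrable (fun y => ‖covariantTransform ħ θ f (x, y)‖ ^ 2) ∧
      ∫ y, ‖covariantTransform ħ θ f (x, y)‖ ^ 2
        = (ħ ^ n)⁻¹ * ∫ t, ‖f t‖ ^ 2 * ‖θ (t - x)‖ ^ 2 := by
  have h1 : ∀ y, ‖covariantTransform ħ θ f (x, y)‖ ^ 2
      = ‖𝓕⁻ (translateMul θ f x) (ħ • y)‖ ^ 2 := by
    intro y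
    rw [covariantTransform_eq_fourierInv, norm_mul, norm_phaseFactor, one_mul]
  simp_rw [h1]
  refine ⟨(integrable_norm_sq volume (𝓕⁻ (translateMul θ f x))).comp_smul hħ.ne', ?_⟩
  rw [Measure.integral_comp_smul volume (fun y => ‖𝓕⁻ (translateMul θ f x) y‖ ^ 2) ħ,
    integral_norm_sq_fourierInv, finrank_euclideanSpace_fin, abs_of_pos (by positivity), smul_eq_mul]
  congr 2
  ext t
  rw [translateMul_apply, norm_mul, RCLike.norm_conj]
  ring

theorem continuous_covariantTransform_integrand (ħ : ℝ) (θ f : 𝓢(Config n, ℂ)) :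
    Continuous fun z : Phase n × Config n => f z.2 * conj (schrodinger ħ 0 z.1 θ z.2) := by
  unfold schrodinger
  fun_prop

/-- Plancherel in y for each x, where the dilation by ħ contributes ħ^(-n), then Fubini: integrating
‖θ(t - x)‖² over x separates the two norms. -/
theorem memLp_covariantTransform {ħ : ℝ} (hħ : 0 < ħ) (θ f : 𝓢(Config n, ℂ)) :
    MemLp (covariantTransform ħ θ f) 2 (volume : Measure (Phase n)) ∧
    ∫ p, ‖covariantTransform ħ θ f p‖ ^ 2
      = (ħ ^ n)⁻¹ * (∫ t, ‖θ t‖ ^ 2) * ∫ t, ‖f t‖ ^ 2 := by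
  have hmeas : AEStronglyMeasurable (covariantTransform ħ θ f) (volume : Measure (Phase n)) :=
    (continuous_covariantTransform_integrand ħ θ f).aestronglyMeasurable.integral_prod_right'
      (ν := volume)
  have hconv : Integrable (fun z : Config n × Config n => ‖f z.2‖ ^ 2 * ‖θ (z.2 - z.1)‖ ^ 2)
      (volume.prod volume) := by
    have h := (integrable_norm_sq volume f).convolution_integrand (ContinuousLinearMap.mul ℝ ℝ)
      (integrable_norm_sq volume θ).comp_neg
    simpa using h
  have hint : Integrable (fun p : Phase n => ‖covariantTransform ħ θ f p‖ ^ 2)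
      (volume.prod volume) := by
    have hmeas2 : AEStronglyMeasurable (fun p : Phase n => ‖covariantTransform ħ θ f p‖ ^ 2)
        (volume.prod volume) := hmeas.norm.pow 2
    rw [integrable_prod_iff hmeas2]
    refine ⟨Filter.Eventually.of_forall fun x =>
      (integral_norm_sq_covariantTransform_snd hħ θ f x).1, ?_⟩
    have : ∀ x, ∫ y, ‖‖covariantTransform ħ θ f (x, y)‖ ^ 2‖
        = (ħ ^ n)⁻¹ * ∫ t, ‖f t‖ ^ 2 * ‖θ (t - x)‖ ^ 2 := by
      intro x
      rw [← (integral_norm_sq_covariantTransform_snd hħ θ f x).2]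
      simp
    simp_rw [this]
    exact hconv.integral_prod_left.const_mul _
  refine ⟨(memLp_two_iff_integrable_sq_norm hmeas).2 hint, ?_⟩
  rw [Measure.volume_eq_prod, integral_prod _ hint]
  simp_rw [fun x : Config n => (integral_norm_sq_covariantTransform_snd hħ θ f x).2]
  have h3 : ∀ t, ∫ x, ‖f t‖ ^ 2 * ‖θ (t - x)‖ ^ 2 = (∫ s, ‖θ s‖ ^ 2) * ‖f t‖ ^ 2 := by
    intro t
    rw [integral_const_mul, integral_sub_left_eq_self (fun s : Config n => ‖θ s‖ ^ 2) volume t,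
      mul_comm]
  rw [integral_const_mul, integral_integral_swap hconv, mul_assoc]
  simp_rw [h3]
  rw [integral_const_mul]

end Plancherel

theorem covariantTransform_schwartz (ħ : ℝ) (θ f : 𝓢(Config n, ℂ)) (g : Phase n) :
    covariantTransform ħ θ f g
      = inner ℂ (configToL2 (schrodingerS ħ g θ)) (configToL2 f) := by
  rw [← covariantTransform_eq_inner, covariantTransform_congr_ae ħ θ (coeFn_configToL2 f)]

theorem norm_sq_eq_integral (a : L2Phase n) : ‖a‖ ^ 2 = ∫ p, ‖a p‖ ^ 2 := by
  have h1 : inner ℂ a a = ((∫ p, ‖a p‖ ^ 2 : ℝ) : ℂ) := by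
    rw [L2.inner_def, ← integral_complex_ofReal]
    congr 1
    ext p
    rw [inner_self_eq_norm_sq_to_K]
    simp
  rw [@norm_sq_eq_re_inner ℂ, h1]
  rfl

/-- The covariant transform of Schwartz functions. -/
def transformS {ħ : ℝ} (hħ : 0 < ħ) (θ : 𝓢(Config n, ℂ)) : 𝓢(Config n, ℂ) →ₗ[ℂ] L2Phase n where
  toFun f := (memLp_covariantTransform hħ θ f).1.toLp
  map_add' f f' := by
    rw [← MemLp.toLp_add]
    congr 1
    ext g
    rw [Pi.add_apply, covariantTransform_schwartz, covariantTransform_schwartz,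
      covariantTransform_schwartz, map_add, inner_add_right]
  map_smul' c f := by
    rw [RingHom.id_apply, ← MemLp.toLp_const_smul]
    congr 1
    ext g
    rw [Pi.smul_apply, covariantTransform_schwartz, covariantTransform_schwartz, map_smul,
      inner_smul_right, smul_eq_mul]

theorem transformS_ae_eq {ħ : ℝ} (hħ : 0 < ħ) (θ f : 𝓢(Config n, ℂ)) :
    transformS hħ θ f =ᵐ[volume] covariantTransform ħ θ f :=
  (memLp_covariantTransform hħ θ f).1.coeFn_toLp

/-- The norm of the covariant transform. -/
def transformNorm (ħ : ℝ) (θ : 𝓢(Config n, ℂ)) : ℝ := √((ħ ^ n)⁻¹ * ∫ t, ‖θ t‖ ^ 2)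

theorem norm_transformS {ħ : ℝ} (hħ : 0 < ħ) (θ f : 𝓢(Config n, ℂ)) :
    ‖transformS hħ θ f‖ = transformNorm ħ θ * ‖configToL2 f‖ := by
  have hc : 0 ≤ (ħ ^ n)⁻¹ * ∫ t, ‖θ t‖ ^ 2 :=
    mul_nonneg (by positivity) (integral_nonneg fun t => by positivity)
  have h0 : 0 ≤ transformNorm ħ θ := Real.sqrt_nonneg _
  rw [← sq_eq_sq₀ (norm_nonneg _) (mul_nonneg h0 (norm_nonneg _)), mul_pow,
    transformNorm, Real.sq_sqrt hc, norm_sq_configToL2, ← (memLp_covariantTransform hħ θ f).2,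
    norm_sq_eq_integral]
  refine integral_congr_ae ?_
  filter_upwards [transformS_ae_eq hħ θ f] with p hp
  rw [hp]

/-- The covariant transform with the fiducial vector `θ` as a bounded operator. -/
def transform {ħ : ℝ} (hħ : 0 < ħ) (θ : 𝓢(Config n, ℂ)) : L2Config n →L[ℂ] L2Phase n :=
  (transformS hħ θ).extendOfNorm configToL2.toLinearMap

theorem transform_configToL2 {ħ : ℝ} (hħ : 0 < ħ) (θ f : 𝓢(Config n, ℂ)) :
    transform hħ θ (configToL2 f) = transformS hħ θ f :=
  LinearMap.extendOfNorm_eq (e := configToL2.toLinearMap) denseRange_configToL2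
    ⟨transformNorm ħ θ, fun f => (norm_transformS hħ θ f).le⟩ f

theorem norm_transform {ħ : ℝ} (hħ : 0 < ħ) (θ : 𝓢(Config n, ℂ)) (f : L2Config n) :
    ‖transform hħ θ f‖ = transformNorm ħ θ * ‖f‖ := by
  induction f using DenseRange.induction_on denseRange_configToL2 with
  | hp => exact isClosed_eq (transform hħ θ).continuous.norm (continuous_const.mul continuous_norm)
  | ih f => rw [transform_configToL2, norm_transformS]

/-- The operator is defined by extension, the transform by an integral. Along Schwartz approximants
the integral converges at every point, being an inner product with a fixed vector, while L²
convergence gives an almost everywhere convergent subsequence. -/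
theorem transform_ae_eq {ħ : ℝ} (hħ : 0 < ħ) (θ : 𝓢(Config n, ℂ)) (f : L2Config n) :
    transform hħ θ f =ᵐ[volume] covariantTransform ħ θ f := by
  obtain ⟨u, hu, hlim⟩ := mem_closure_iff_seq_limit.1 (denseRange_configToL2 f)
  choose v hv using hu
  have h1 : Filter.Tendsto (fun k => transform hħ θ (u k)) Filter.atTop
      (nhds (transform hħ θ f)) := ((transform hħ θ).continuous.tendsto f).comp hlim
  obtain ⟨ns, hns, hae⟩ := (tendstoInMeasure_of_tendsto_Lp h1).exists_seq_tendsto_ae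
  have h2 : ∀ᵐ p : Phase n, ∀ k, transform hħ θ (u k) p = covariantTransform ħ θ (v k) p := by
    rw [ae_all_iff]
    intro k
    rw [← hv k, transform_configToL2]
    exact transformS_ae_eq hħ θ (v k)
  filter_upwards [hae, h2] with p hp hp2
  refine tendsto_nhds_unique hp ?_
  rw [covariantTransform_eq_inner]
  have h3 : Filter.Tendsto (fun k => inner ℂ (configToL2 (schrodingerS ħ p θ)) (u (ns k)))
      Filter.atTop (nhds (inner ℂ (configToL2 (schrodingerS ħ p θ)) f)) :=
    tendsto_const_nhds.inner (hlim.comp hns.tendsto_atTop)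
  refine h3.congr fun k => ?_
  rw [hp2, covariantTransform_schwartz, ← hv]

/-- W is a multiple of an isometry, so W*W minus the scalar has zero quadratic form and vanishes
over ℂ. -/
theorem adjoint_transform_transform {ħ : ℝ} (hħ : 0 < ħ) (θ : 𝓢(Config n, ℂ)) (f : L2Config n) :
    ContinuousLinearMap.adjoint (transform hħ θ) (transform hħ θ f)
      = ((transformNorm ħ θ ^ 2 : ℝ) : ℂ) • f := by
  set T : L2Config n →ₗ[ℂ] L2Config n :=
    (ContinuousLinearMap.adjoint (transform hħ θ) ∘L transform hħ θ
      - ((transformNorm ħ θ ^ 2 : ℝ) : ℂ) • ContinuousLinearMap.id ℂ _).toLinearMap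
  have hT : T = 0 := by
    rw [← inner_map_self_eq_zero]
    intro f
    change inner ℂ (ContinuousLinearMap.adjoint (transform hħ θ) (transform hħ θ f)
      - ((transformNorm ħ θ ^ 2 : ℝ) : ℂ) • f) f = 0
    rw [inner_sub_left, ContinuousLinearMap.adjoint_inner_left, inner_self_eq_norm_sq_to_K,
      norm_transform, inner_smul_left, inner_self_eq_norm_sq_to_K]
    simp
    ring
  have := LinearMap.congr_fun hT f
  exact sub_eq_zero.1 this

/-- If `Φ` is a Schwartz representative of the covariant transform of `θ` itself, then the integrated
right pulled action of `Φ` is the product of the covariant transform and its adjoint. -/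
theorem conv_eq_transform_adjoint {ħ : ℝ} (hħ : 0 < ħ) (θ : 𝓢(Config n, ℂ)) (Φ : 𝓢(Phase n, ℂ))
    (hΦ : (Φ : Phase n → ℂ) = covariantTransform ħ θ θ) (a : L2Phase n) :
    conv ħ Φ a = transform hħ θ (ContinuousLinearMap.adjoint (transform hħ θ) a) := by
  refine toDist_ext fun ψ => ?_
  rw [← conjS_conjS ψ]
  set v := conjS ψ
  -- Intertwining: Λ(g) applied to Φ = Wθ is W applied to the Schrödinger translate of θ.
  have h1 : ∀ g, toL2 (twist ħ g (-g) Φ)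
      = transform hħ θ (configToL2 (schrodingerS ħ g θ)) := by
    intro g
    refine Lp.ext ?_
    filter_upwards [coeFn_toL2 (twist ħ g (-g) Φ),
      transform_ae_eq hħ θ (configToL2 (schrodingerS ħ g θ))] with p hp hp2
    rw [hp, hp2, covariantTransform_congr_ae ħ θ (coeFn_configToL2 _),
      covariantTransform_schrodingerS, twist_apply, hΦ, sub_eq_add_neg]
  -- The pairing of W(ρ(g)θ) with v becomes that of ρ(g)θ with W*v, the conjugate of the transform
  -- of W*v at g.
  have h2 : ∀ g, coef ħ Φ (conjS v) g = conj (covariantTransform ħ θ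
      (ContinuousLinearMap.adjoint (transform hħ θ) (toL2 v)) g) := by
    intro g
    rw [covariantTransform_eq_inner, ContinuousLinearMap.adjoint_inner_right, ← h1, inner_conj_symm,
      ← toDist_conjS, toDist_toL2, coef_apply, coefFun]
    congr 1
    ext p
    ring
  have h3 : toDist (conv ħ Φ a) (conjS v) = inner ℂ
      (transform hħ θ (ContinuousLinearMap.adjoint (transform hħ θ) (toL2 v))) a := by
    rw [toDist_conv, toDist_apply, L2.inner_def]
    refine integral_congr_ae ?_
    filter_upwards [transform_ae_eq hħ θ
      (ContinuousLinearMap.adjoint (transform hħ θ) (toL2 v))] with p hp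
    rw [hp, h2]
    exact mul_comm _ _
  rw [h3, toDist_conjS, ← ContinuousLinearMap.adjoint_inner_right (transform hħ θ),
    ContinuousLinearMap.adjoint_inner_left]

theorem mem_preFSBSpace_iff {ħ τ : ℝ} (hħ : 0 < ħ) {θ : 𝓢(Config n, ℂ)}
    (hθ : (θ : Config n → ℂ) = gaussian ħ τ) (F : L2Phase n) :
    F ∈ preFSBSpace n ħ τ ↔ ∃ f, F = transform hħ θ f := by
  refine exists_congr fun f => ?_
  rw [← hθ]
  refine ⟨fun h => Lp.ext (h.trans (transform_ae_eq hħ θ f).symm), ?_⟩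
  rintro rfl
  exact transform_ae_eq hħ θ f

theorem transformNorm_pos {ħ τ : ℝ} (hħ : 0 < ħ) {θ : 𝓢(Config n, ℂ)}
    (hθ : (θ : Config n → ℂ) = gaussian ħ τ) : 0 < transformNorm ħ θ := by
  refine Real.sqrt_pos.2 (mul_pos (by positivity) ?_)
  rw [integral_pos_iff_support_of_nonneg (fun t => by positivity) (integrable_norm_sq volume θ)]
  have : Function.support (fun t => ‖θ t‖ ^ 2) = Set.univ := by
    ext t
    simp [hθ, gaussian]
  rw [this]
  exact Measure.measure_univ_pos.2 (NeZero.ne _)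

/-! ### Ladder operators -/

/-- The basis vector `X_j` of phase space. -/
def basisX (j : Fin n) : Phase n := (EuclideanSpace.single j 1, 0)

/-- The basis vector `Y_j` of phase space. -/
def basisY (j : Fin n) : Phase n := (0, EuclideanSpace.single j 1)

theorem symp_basisX (j : Fin n) (p : Phase n) : symp n (basisX j) p = p.2 j := by
  simp [symp_apply, basisX, EuclideanSpace.inner_single_left]

theorem symp_basisY (j : Fin n) (p : Phase n) : symp n (basisY j) p = -p.1 j := by
  simp [symp_apply, basisY, EuclideanSpace.inner_single_left]

theorem eq_sum_basis (e : Phase n) :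
    e = ∑ j, (e.1 j • basisX j + e.2 j • basisY j) := by
  have h (x : Config n) : x = ∑ j, x j • EuclideanSpace.single j (1 : ℝ) := by
    ext i
    simp [Finset.sum_apply, Pi.single_apply]
  refine Prod.ext ?_ ?_
  · simpa [Prod.fst_sum, basisX, basisY] using h e.1
  · simpa [Prod.snd_sum, basisX, basisY] using h e.2

/-- Operators on distributions act by transposition on the test function, which is where `derL`
comes from. -/
theorem dRX_apply (ħ : ℝ) (j : Fin n) (T : 𝓢'(Phase n, ℂ)) (ψ : 𝓢(Phase n, ℂ)) :
    dRX ħ j T ψ = T (derL ħ (basisX j) ψ) := by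
  have h : smulLeftCLM ℂ (fun p : Phase n => ((p.2 j : ℝ) : ℂ)) ψ
      = linMul (symp n (basisX j)) ψ := by
    simp only [linMul, symp_basisX]
  change (Real.pi * Complex.I * ħ : ℂ) • T (smulLeftCLM ℂ (fun p : Phase n => ((p.2 j : ℝ) : ℂ)) ψ)
    + (∂_{basisX j} T) ψ = _
  rw [h, TemperedDistribution.lineDerivOp_apply_apply, derL, add_apply, neg_apply, smul_apply,
    map_add, map_smul, add_comm]
  rfl

theorem dRY_apply (ħ : ℝ) (j : Fin n) (T : 𝓢'(Phase n, ℂ)) (ψ : 𝓢(Phase n, ℂ)) :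
    dRY ħ j T ψ = T (derL ħ (basisY j) ψ) := by
  have hg : (fun p : Phase n => ((p.1 j : ℝ) : ℂ)).HasTemperateGrowth := by
    convert! ofReal_clm_hasTemperateGrowth (-symp n (basisY j)) using 2 with p
    simp [symp_basisY]
  have h : smulLeftCLM ℂ (fun p : Phase n => ((p.1 j : ℝ) : ℂ)) ψ
      = -linMul (symp n (basisY j)) ψ := by
    ext p
    simp [smulLeftCLM_apply_apply hg, symp_basisY]
  change (-(Real.pi * Complex.I * ħ) : ℂ) • T (smulLeftCLM ℂ (fun p : Phase n => ((p.1 j : ℝ) : ℂ)) ψ)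
    + (∂_{basisY j} T) ψ = _
  rw [h, TemperedDistribution.lineDerivOp_apply_apply, derL, add_apply, neg_apply, smul_apply,
    map_add, map_smul, add_comm, map_neg T (linMul _ _), smul_neg, neg_smul, neg_neg]
  rfl

/-- Combinations of the derived right pulled actions of `X_j` and `Y_j`. -/
def ladder (ħ : ℝ) (j : Fin n) (α β : ℂ) : DistOp n := α • dRX ħ j + β • dRY ħ j

/-- The operator `ladder ħ j α β` on Schwartz functions. -/
def ladderS (ħ : ℝ) (j : Fin n) (α β : ℂ) : 𝓢(Phase n, ℂ) →L[ℂ] 𝓢(Phase n, ℂ) :=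
  α • derR ħ (basisX j) + β • derR ħ (basisY j)

theorem ladder_apply (ħ : ℝ) (j : Fin n) (α β : ℂ) (T : 𝓢'(Phase n, ℂ)) (ψ : 𝓢(Phase n, ℂ)) :
    ladder ħ j α β T ψ
      = α * T (derL ħ (basisX j) ψ) + β * T (derL ħ (basisY j) ψ) := by
  rw [← dRX_apply, ← dRY_apply]
  rfl

theorem rightLadderPlus_eq (ħ τ : ℝ) (j : Fin n) :
    rightLadderPlus ħ τ j = ladder ħ j (((1 / √(2 * |2 * Real.pi * ħ| * τ) : ℝ) : ℂ) * τ)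
      (((1 / √(2 * |2 * Real.pi * ħ| * τ) : ℝ) : ℂ) * Complex.I) := by
  rw [rightLadderPlus, ladder, smul_add, smul_smul, smul_smul]

theorem rightLadderMinus_eq (ħ τ : ℝ) (j : Fin n) :
    rightLadderMinus ħ τ j = ladder ħ j (((1 / √(2 * |2 * Real.pi * ħ| * τ) : ℝ) : ℂ) * -τ)
      (((1 / √(2 * |2 * Real.pi * ħ| * τ) : ℝ) : ℂ) * Complex.I) := by
  rw [rightLadderMinus, ladder, smul_add, smul_smul, smul_smul]

theorem toDist_toL2_derR (ħ : ℝ) (e : Phase n) (u ψ : 𝓢(Phase n, ℂ)) :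
    toDist (toL2 (derR ħ e u)) ψ = toDist (toL2 u) (derL ħ e ψ) := by
  simp only [toDist_toL2, mul_comm (ψ _), mul_comm (derL ħ e ψ _)]
  exact integral_derR_mul ħ e u ψ

theorem toDist_toL2_ladderS (ħ : ℝ) (j : Fin n) (α β : ℂ) (u : 𝓢(Phase n, ℂ)) :
    toDist (toL2 (ladderS ħ j α β u)) = ladder ħ j α β (toDist (toL2 u)) := by
  ext ψ
  rw [ladder_apply, ← toDist_toL2_derR, ← toDist_toL2_derR]
  simp only [← toDistCLM_apply, ladderS, add_apply, smul_apply, map_add, map_smul, smul_eq_mul]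

theorem CommutesWith.ladder_apply {ħ : ℝ} {j : Fin n} {α β : ℂ} {A : L2Phase n →L[ℂ] L2Phase n}
    (hA : CommutesWith A (ladder ħ j α β)) (u ψ : 𝓢(Phase n, ℂ)) :
    α * toDist (A (toL2 u)) (derL ħ (basisX j) ψ) + β * toDist (A (toL2 u)) (derL ħ (basisY j) ψ)
      = α * toDist (A (toL2 (derR ħ (basisX j) u))) ψ
        + β * toDist (A (toL2 (derR ħ (basisY j) u))) ψ := by
  -- The L² function representing the ladder operator applied to u is the class of a Schwartz
  -- function.
  have h := hA u (toL2 (ladderS ħ j α β u))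
    (by rw [toLp_eq_toL2]; exact toDist_toL2_ladderS ħ j α β u)
  rw [toLp_eq_toL2] at h
  rw [← FockHeisenberg.ladder_apply, h]
  simp only [← toDistCLM_apply, ladderS, add_apply, smul_apply, map_add, map_smul, smul_eq_mul]

theorem commutesWithDerR_of_basis {ħ : ℝ} {A : L2Phase n →L[ℂ] L2Phase n}
    (hX : ∀ (j : Fin n) (u ψ : 𝓢(Phase n, ℂ)), toDist (A (toL2 (derR ħ (basisX j) u))) ψ
      = toDist (A (toL2 u)) (derL ħ (basisX j) ψ))
    (hY : ∀ (j : Fin n) (u ψ : 𝓢(Phase n, ℂ)), toDist (A (toL2 (derR ħ (basisY j) u))) ψ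
      = toDist (A (toL2 u)) (derL ħ (basisY j) ψ)) :
    CommutesWithDerR ħ A := by
  intro e u ψ
  -- Both sides are real linear in the direction e, so the good directions form a subspace, and it
  -- contains the basis.
  let P : Submodule ℝ (Phase n) :=
    { carrier := {e | toDist (A (toL2 (derR ħ e u))) ψ = toDist (A (toL2 u)) (derL ħ e ψ)}
      add_mem' := fun {e e'} he he' => by
        simp only [Set.mem_ofPred_eq, ← toDistCLM_apply] at he he' ⊢
        rw [derR_add, derL_add, add_apply, add_apply, map_add, map_add, map_add, he, he']
        simp
      zero_mem' := by
        have h1 : derR ħ (0 : Phase n) = 0 := by simpa using derR_smul ħ 0 (0 : Phase n)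
        have h2 : derL ħ (0 : Phase n) = 0 := by simpa using derL_smul ħ 0 (0 : Phase n)
        simp only [Set.mem_ofPred_eq, ← toDistCLM_apply]
        rw [h1, h2, zero_apply, zero_apply, map_zero, map_zero, map_zero]
        simp
      smul_mem' := fun c e he => by
        simp only [Set.mem_ofPred_eq, ← toDistCLM_apply] at he ⊢
        rw [derR_smul, derL_smul, smul_apply, smul_apply, map_smul, map_smul, map_smul, he,
          toDistCLM_apply, toDistCLM_apply, map_smul] }
  change e ∈ P
  rw [eq_sum_basis e]
  exact P.sum_mem fun j _ => P.add_mem (P.smul_mem _ (hX j u ψ)) (P.smul_mem _ (hY j u ψ))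

theorem commutesWithDerR_of_commutesWith {ħ τ : ℝ} (hħ : 0 < ħ) (hτ : 0 < τ)
    {A : L2Phase n →L[ℂ] L2Phase n} (hplus : ∀ j, CommutesWith A (rightLadderPlus ħ τ j))
    (hminus : ∀ j, CommutesWith A (rightLadderMinus ħ τ j)) : CommutesWithDerR ħ A := by
  have hc : ((1 / √(2 * |2 * Real.pi * ħ| * τ) : ℝ) : ℂ) ≠ 0 := by
    have : 0 < 2 * |2 * Real.pi * ħ| * τ := by positivity
    exact Complex.ofReal_ne_zero.2 (by positivity)
  have hτ' : (τ : ℂ) ≠ 0 := Complex.ofReal_ne_zero.2 hτ.ne'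
  have key : ∀ j (u ψ : 𝓢(Phase n, ℂ)), _ ∧ _ := fun j u ψ =>
    ⟨(rightLadderPlus_eq ħ τ j ▸ hplus j).ladder_apply u ψ,
      (rightLadderMinus_eq ħ τ j ▸ hminus j).ladder_apply u ψ⟩
  refine commutesWithDerR_of_basis (fun j u ψ => ?_) fun j u ψ => ?_ <;>
    obtain ⟨h1, h2⟩ := key j u ψ
  -- The difference of the two ladder relations isolates X_j with the factor 2cτ, where c is the
  -- common normalisation; below, their sum isolates Y_j with 2ci.
  · refine mul_left_cancel₀ (mul_ne_zero (mul_ne_zero two_ne_zero hc) hτ') ?_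
    linear_combination h2 - h1
  · refine mul_left_cancel₀ (mul_ne_zero (mul_ne_zero two_ne_zero hc) Complex.I_ne_zero) ?_
    linear_combination -h1 - h2

/-! ### True poly-analytic spaces -/

/-- An operator on distributions which acts on the integrated right pulled action through the
Schwartz function which is integrated. -/
def ActsOnKernel (ħ : ℝ) (T : DistOp n) : Prop :=
  ∀ w : 𝓢(Phase n, ℂ), ∃ w' : 𝓢(Phase n, ℂ), ∀ a, T (toDist (conv ħ w a)) = toDist (conv ħ w' a)

/-- Transposing onto the test function and applying `coef_derL_right` puts the operator on w and
leaves a untouched. -/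
theorem actsOnKernel_ladder (ħ : ℝ) (j : Fin n) (α β : ℂ) : ActsOnKernel ħ (ladder ħ j α β) := by
  refine fun w => ⟨ladderS ħ j α β w, fun a => ?_⟩
  ext ψ
  rw [ladder_apply, toDist_conv, toDist_conv, toDist_conv, coef_derL_right, coef_derL_right, ladderS,
    add_apply, smul_apply, smul_apply, coef_add_left, coef_smul_left, coef_smul_left, map_add,
    map_smul, map_smul, smul_eq_mul, smul_eq_mul]

theorem actsOnKernel_one (ħ : ℝ) : ActsOnKernel ħ (1 : DistOp n) := fun w => ⟨w, fun _ => rfl⟩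

theorem ActsOnKernel.mul {ħ : ℝ} {S T : DistOp n} (hS : ActsOnKernel ħ S) (hT : ActsOnKernel ħ T) :
    ActsOnKernel ħ (S * T) := by
  intro w
  obtain ⟨w', h'⟩ := hT w
  obtain ⟨w'', h''⟩ := hS w'
  refine ⟨w'', fun a => ?_⟩
  rw [← h'', ← h']
  rfl

theorem ActsOnKernel.pow {ħ : ℝ} {T : DistOp n} (hT : ActsOnKernel ħ T) (k : ℕ) :
    ActsOnKernel ħ (T ^ k) := by
  induction k with
  | zero => exact pow_zero T ▸ actsOnKernel_one ħ
  | succ k ih => exact pow_succ T k ▸ ih.mul hT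

theorem actsOnKernel_list_prod {ħ : ℝ} (l : List (DistOp n)) (h : ∀ T ∈ l, ActsOnKernel ħ T) :
    ActsOnKernel ħ l.prod := by
  induction l with
  | nil => exact actsOnKernel_one ħ
  | cons T l ih =>
    rw [List.prod_cons]
    exact (h T List.mem_cons_self).mul (ih fun S hS => h S (List.mem_cons_of_mem T hS))

theorem CommutesWithDerR.mapsTo_truePolyanalyticSpace {ħ τ : ℝ} (hħ : 0 < ħ) (hτ : 0 < τ)
    {A : L2Phase n →L[ℂ] L2Phase n} (hA : CommutesWithDerR ħ A) (m : Fin n → ℕ) :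
    Set.MapsTo A (truePolyanalyticSpace ħ τ m) (truePolyanalyticSpace ħ τ m) := by
  obtain ⟨θ, hθ⟩ := exists_gaussianS n hħ hτ
  obtain ⟨Φ, hΦ⟩ := exists_vacuumS n hħ hτ
  rw [← hθ] at hΦ
  rintro F ⟨f, hf, hF⟩
  set T : DistOp n := (List.ofFn fun j => rightLadderMinus ħ τ j ^ m j).prod
  have hT : ActsOnKernel ħ T := by
    refine actsOnKernel_list_prod _ fun S hS => ?_
    obtain ⟨j, rfl⟩ := List.mem_ofFn.1 hS
    exact ((rightLadderMinus_eq ħ τ j).symm ▸ actsOnKernel_ladder ħ j _ _).pow (m j)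
  obtain ⟨Ψ, hΨ⟩ := hT Φ
  obtain ⟨f₀, rfl⟩ := (mem_preFSBSpace_iff hħ hθ f).1 hf
  set c : ℂ := ((transformNorm ħ θ ^ 2 : ℝ) : ℂ)
  have hc : c ≠ 0 := Complex.ofReal_ne_zero.2 (pow_pos (transformNorm_pos hħ hθ) 2).ne'
  -- F is the range of conv(Φ) = WW*: since W*W = c, the vector Wf₀ is reproduced from c⁻¹Wf₀.
  have h1 : transform hħ θ f₀ = conv ħ Φ (c⁻¹ • transform hħ θ f₀) := by
    rw [conv_eq_transform_adjoint hħ θ Φ hΦ, map_smul, adjoint_transform_transform,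
      inv_smul_smul₀ hc]
  set b := c⁻¹ • transform hħ θ f₀
  have h2 : F = conv ħ Ψ b := toDist_injective (by rw [hF, h1, hΨ])
  -- The preimage of AF in F has the same Φ with b replaced by Ab, because A moves past conv(Ψ).
  refine ⟨conv ħ Φ (A b), ?_, ?_⟩
  · rw [mem_preFSBSpace_iff hħ hθ]
    exact ⟨_, conv_eq_transform_adjoint hħ θ Φ hΦ (A b)⟩
  · rw [h2, hA.conv_apply, ← hΨ]

end FockHeisenberg

end

theorem mainTheorem10 (n : ℕ) (ħ τ : ℝ) (hħ : 0 < ħ) (hτ : 0 < τ)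
    (A : FockHeisenberg.L2Phase n →L[ℂ] FockHeisenberg.L2Phase n)
    (hplus : ∀ j : Fin n, FockHeisenberg.CommutesWith A (FockHeisenberg.rightLadderPlus ħ τ j))
    (hminus : ∀ j : Fin n, FockHeisenberg.CommutesWith A (FockHeisenberg.rightLadderMinus ħ τ j)) :
    (∀ m : Fin n → ℕ, Set.MapsTo A (FockHeisenberg.truePolyanalyticSpace ħ τ m)
      (FockHeisenberg.truePolyanalyticSpace ħ τ m)) ∧
    FockHeisenberg.IsLeftRelativeConvolution ħ A := by
  have hA := FockHeisenberg.commutesWithDerR_of_commutesWith hħ hτ hplus hminus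
  exact ⟨hA.mapsTo_truePolyanalyticSpace hħ hτ, hA.isLeftRelativeConvolution⟩
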